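/- For a finite subgroup $\Gamma\subset U(2)$ let $$\Phi_\Gamma(z,\bar z)=1-\prod_{\gamma\in\Gamma}\bigl(1-\langle\gamma z,z\rangle\bigr),\qquad \langle z,w\rangle=z_1\overline{w_1}+z_2\overline{w_2},$$ and let $N^+(\Gamma)$ and $N^-(\Gamma)$ be the numbers of positive and of negative eigenvalues, counted with multiplicity, of the Hermitian matrix of coefficients $(C_{\alpha\beta})$ of $\Phi_\Gamma=\sum_{\alpha,\beta}C_{\alpha\beta}z^\alpha\bar z^\beta$; put $N(\Gamma)=N^+(\Gamma)+N^-(\Gamma)$. For integers $0\le q_1\le q_2$ with $\gcd(q_1,q_2)=1$ and $p\ge 1$, let $\Gamma_{p;q_1,q_2}\subset U(2)$ be the cyclic group of order $p$ generated by $\begin{pmatrix}\omega^{q_1}&0\\0&\omega^{q_2}\end{pmatrix}$, where $\omega$ is a primitive $p$-th root of unity. Then for every such pair $q_1,q_2$ $$\lim_{p\to\infty}\frac{N^+(\Gamma_{p;q_1,q_2})}{N(\Gamma_{p;q_1,q_2})}=\begin{cases}\dfrac{3q_1(q_2-q_1)+1}{4q_1(q_2-q_1)}&\text{for $q_1$ odd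 and $q_2$ even,}\\[2mm]\dfrac{3q_1q_2+1}{4q_1q_2}&\text{for $q_1$ odd and $q_2$ odd,}\\[2mm]\dfrac{3q_2(q_2-q_1)-1}{4q_2(q_2-q_1)}&\text{for $q_1$ even and $q_2$ odd,}\end{cases}$$ and hence $$\lim_{q_1\to\infty}\ \lim_{q_2\to\infty}\ \lim_{p\to\infty}\frac{N^+(\Gamma_{p;q_1,q_2})}{N(\Gamma_{p;q_1,q_2})}=\frac34,$$ where, for fixed $q_1\ge1$, $q_2\to\infty$ through the integers coprime to $q_1$. -/

import Mathlib

open Filter Topology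
open scoped ComplexOrder

noncomputable section

/-- The Hermitian form `⟨γ z, z⟩ = ∑ i, (γ z)_i * conj z_i` of a matrix `γ`, as a polynomial in the
variables `z_j = X (Sum.inl j)` and their conjugates `conj z_i = X (Sum.inr i)`. -/
def hermitianPairing {n : ℕ} (γ : Matrix (Fin n) (Fin n) ℂ) :
    MvPolynomial (Fin n ⊕ Fin n) ℂ :=
  ∑ i, (∑ j, MvPolynomial.C (γ i j) * MvPolynomial.X (Sum.inl j)) * MvPolynomial.X (Sum.inr i)

/-- `Φ_Γ(z, conj z) = 1 - ∏_{γ ∈ Γ} (1 - ⟨γ z, z⟩)` for a finite subgroup `Γ` of `U(n)`. -/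
def invariantPoly {n : ℕ} (Γ : Subgroup (Matrix.unitaryGroup (Fin n) ℂ)) :
    MvPolynomial (Fin n ⊕ Fin n) ℂ :=
  1 - ∏ᶠ γ : Γ, (1 - hermitianPairing ((γ : Matrix.unitaryGroup (Fin n) ℂ) :
    Matrix (Fin n) (Fin n) ℂ))

/-- The matrix of coefficients of `Φ_Γ`: its `(α, β)` entry is the coefficient of
`z ^ α * conj z ^ β`. As `Φ_Γ` has degree at most `|Γ|` in each variable, the multi-indices with
entries in `{0, …, |Γ|}` exhaust all the coefficients of `Φ_Γ`. -/
def coeffMatrix {n : ℕ} (Γ : Subgroup (Matrix.unitaryGroup (Fin n) ℂ)) :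
    Matrix (Fin n → Fin (Nat.card Γ + 1)) (Fin n → Fin (Nat.card Γ + 1)) ℂ :=
  fun α β => (invariantPoly Γ).coeff
    (Finsupp.equivFunOnFinite.symm (Sum.elim (fun i => (α i : ℕ)) (fun i => (β i : ℕ))))

open Classical in
/-- `N⁺(Γ)`: the number of positive eigenvalues, with multiplicity, of the (Hermitian) matrix of
coefficients of `Φ_Γ`. -/
def numPos {n : ℕ} (Γ : Subgroup (Matrix.unitaryGroup (Fin n) ℂ)) : ℕ :=
  (coeffMatrix Γ).charpoly.roots.countP (fun μ => 0 < μ)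

open Classical in
/-- `N⁻(Γ)`: the number of negative eigenvalues, with multiplicity, of the (Hermitian) matrix of
coefficients of `Φ_Γ`. -/
def numNeg {n : ℕ} (Γ : Subgroup (Matrix.unitaryGroup (Fin n) ℂ)) : ℕ :=
  (coeffMatrix Γ).charpoly.roots.countP (fun μ => μ < 0)

/-- The positivity ratio `N⁺(Γ) / N(Γ)`, where `N = N⁺ + N⁻`. -/
def positivityRatio {n : ℕ} (Γ : Subgroup (Matrix.unitaryGroup (Fin n) ℂ)) : ℝ :=
  (numPos Γ : ℝ) / ((numPos Γ : ℝ) + (numNeg Γ : ℝ))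

/-- The diagonal unitary matrix with diagonal entries `ω ^ q₁`, `ω ^ q₂`, for `|ω| = 1`. -/
def cyclicGenerator (ω : Circle) (q₁ q₂ : ℕ) : Matrix.unitaryGroup (Fin 2) ℂ :=
  ⟨Matrix.diagonal ![(ω : ℂ) ^ q₁, (ω : ℂ) ^ q₂], by
    have h : ∀ k : ℕ, (ω : ℂ) ^ k * (starRingEnd ℂ) ((ω : ℂ) ^ k) = 1 := by
      intro k
      rw [Complex.mul_conj, Complex.normSq_eq_norm_sq, norm_pow, Circle.norm_coe]
      simp
    rw [Matrix.mem_unitaryGroup_iff, Matrix.star_eq_conjTranspose, Matrix.diagonal_conjTranspose,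
      Matrix.diagonal_mul_diagonal, ← Matrix.diagonal_one]
    congr 1
    funext i
    fin_cases i
    · exact h q₁
    · exact h q₂⟩

/-- The cyclic subgroup `Γ_{p;q₁,q₂}` of `U(2)`, where `ω` is a primitive `p`-th root of unity. -/
def cyclicGroup (ω : Circle) (q₁ q₂ : ℕ) : Subgroup (Matrix.unitaryGroup (Fin 2) ℂ) :=
  Subgroup.zpowers (cyclicGenerator ω q₁ q₂)

end

/-! Write a = q₁, b = q₂, x = |z₁|², y = |z₂|². For the cyclic group, Φ is a polynomial in x and y
alone, so the coefficient matrix is diagonal and its eigenvalues are the coefficients of 1 - ∏ⱼ (1 -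
ω^(ja) x - ω^(jb) y).

The product is det(1 - x S^a - y S^b), where S is the cyclic shift of `ZMod p`
(`MvPolynomial.prod_eq_det_shift`). Expanding the determinant, the coefficient of x^r y^s is a
signed count of the permutations of `ZMod p` that move r labelled points by a, s by b, and fix the
others. The crucial fact is that nothing cancels: the sign depends only on (r, s)
(`ZMod.neg_one_pow_mul_sign_of_displacements`). It is + exactly when r and s are even and p ∣ (r/2)a
+ (s/2)b, that is, when (r, s) is twice a point of the lattice p ∣ ra + sb. Such permutations exist
exactly when r + s ≤ p and p ∣ ra + sb (`ZMod.exists_bijective_displacement`).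

Because of the minus sign in Φ, N⁻ counts the doubled nonzero lattice points in the triangle r + s ≤
p, and N counts all its nonzero lattice points. Hence N + 1 and N⁻ + 1 are lattice point counts in
the triangles r + s ≤ p and 2(r + s) ≤ p.

The lattice points lie on the lines ra + sb = kp with 0 ≤ k ≤ b. For fixed a, b each line carries a
number of points proportional to p, up to a bounded error, so both counts divided by p converge to
finite sums of line lengths. The lines stay macroscopically far apart, so the sums are not areas:
the floors of a/2 and b/2 enter the smaller triangle, and they give the dependence on parity. The
correction to 3/4 vanishes as q₂ → ∞ already for fixed q₁. -/

/-! ### Signs of permutations by counting inversions. -/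

theorem Equiv.Perm.sign_eq_prod_lt {α : Type*} [Fintype α] [DecidableEq α] (σ : Equiv.Perm α)
    (v : α → ℕ) (hv : Function.Injective v) :
    Equiv.Perm.sign σ = ∏ q : α × α with v q.1 < v q.2,
      (if v (σ q.1) < v (σ q.2) then 1 else -1 : ℤˣ) := by
  let _ : LinearOrder α := LinearOrder.lift' v hv
  have hlt : ∀ x y : α, x < y ↔ v x < v y := fun x y => Iff.rfl
  let e : Fin (Fintype.card α) ≃o α := Fintype.orderIsoFinOfCardEq α rfl
  rw [← Equiv.Perm.sign_permCongr e.symm.toEquiv σ, Equiv.Perm.sign_eq_prod_prod_Ioi,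
    Finset.prod_sigma']
  refine Finset.prod_bij' (fun q _ => (e q.1, e q.2)) (fun q _ => ⟨e.symm q.1, e.symm q.2⟩)
    ?_ ?_ ?_ ?_ ?_
  · rintro ⟨i, j⟩ h
    simpa [← hlt] using h
  · rintro ⟨x, y⟩ h
    simpa [← hlt] using h
  · simp
  · simp
  · rintro ⟨i, j⟩ h
    simp only [← hlt, Equiv.permCongr_apply]
    congr 1
    simp

/-- Each x contributes `g x` once for every related y ≠ x, as the smaller or as the larger member of
the pair. -/
theorem Finset.prod_lt_mul_symm {α M : Type*} [Fintype α] [DecidableEq α] [CommMonoid M]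
    (v : α → ℕ) (hv : Function.Injective v) (R : α → α → Prop) [DecidableRel R]
    (hR : ∀ x y, R x y → R y x) (g : α → M) :
    ∏ q : α × α with v q.1 < v q.2, (if R q.1 q.2 then g q.1 * g q.2 else 1) =
      ∏ x, g x ^ (Finset.card {y | y ≠ x ∧ R x y}) := by
  have h1 : ∏ q : α × α with v q.1 < v q.2, (if R q.1 q.2 then g q.1 * g q.2 else 1) =
      (∏ q : α × α with v q.1 < v q.2, (if R q.1 q.2 then g q.1 else 1)) *
      ∏ q : α × α with v q.2 < v q.1, (if R q.1 q.2 then g q.1 else 1) := by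
    have h2 : ∏ q : α × α with v q.2 < v q.1, (if R q.1 q.2 then g q.1 else 1) =
        ∏ q : α × α with v q.1 < v q.2, (if R q.1 q.2 then g q.2 else 1) := by
      refine Finset.prod_bij' (fun q _ => q.swap) (fun q _ => q.swap) ?_ ?_ ?_ ?_ ?_
      · simp
      · simp
      · simp
      · simp
      · rintro ⟨x, y⟩ _
        have : R x y ↔ R y x := ⟨hR x y, hR y x⟩
        simp [this]
    rw [h2, ← Finset.prod_mul_distrib]
    refine Finset.prod_congr rfl fun q _ => ?_
    split_ifs <;> simp
  rw [h1, ← Finset.prod_union]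
  · rw [← Finset.filter_or]
    have h3 : ∀ x : α, g x ^ (Finset.card {y | y ≠ x ∧ R x y}) =
        ∏ y, if y ≠ x ∧ R x y then g x else 1 := by
      intro x
      rw [← Finset.prod_filter, Finset.prod_const]
    simp_rw [h3]
    rw [Finset.prod_filter, ← Finset.univ_product_univ, Finset.prod_product]
    refine Finset.prod_congr rfl fun x _ => Finset.prod_congr rfl fun y _ => ?_
    have : (v x < v y ∨ v y < v x) ↔ y ≠ x := by
      rw [← ne_iff_lt_or_gt, hv.ne_iff, ne_comm]
    simp only [this]
    by_cases h : y = x <;> simp [h]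
  · rw [Finset.disjoint_left]
    intro q
    simp only [Finset.mem_filter, Finset.mem_univ, true_and]
    omega

/-- The sign of a permutation whose inversions are governed, within the fibres of `J`, by a sign
`η`, and between different fibres by a sign `θ`. -/
theorem Equiv.Perm.sign_eq_of_fibres {α ι : Type*} [Fintype α] [DecidableEq α] [DecidableEq ι]
    (σ : Equiv.Perm α) (v : α → ℕ) (hv : Function.Injective v) (J : α → ι) (η θ : α → ℤˣ)
    (h : ∀ x y, v x < v y → (if v (σ x) < v (σ y) then 1 else -1 : ℤˣ) =
      if J x = J y then η x * η y else θ x * θ y)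
    (m : ℕ) (hm : ∀ x, Finset.card {y | J y = J x} = m) :
    Equiv.Perm.sign σ = (∏ x, η x) ^ (m - 1) * (∏ x, θ x) ^ (Fintype.card α - m) := by
  rw [σ.sign_eq_prod_lt v hv]
  have h1 : ∏ q : α × α with v q.1 < v q.2, (if v (σ q.1) < v (σ q.2) then 1 else -1 : ℤˣ) =
      ∏ q : α × α with v q.1 < v q.2, ((if J q.1 = J q.2 then η q.1 * η q.2 else 1) *
        (if J q.1 ≠ J q.2 then θ q.1 * θ q.2 else 1)) := by
    refine Finset.prod_congr rfl fun q hq => ?_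
    rw [h q.1 q.2 (by simpa using hq)]
    by_cases h : J q.1 = J q.2 <;> simp [h]
  rw [h1, Finset.prod_mul_distrib,
    Finset.prod_lt_mul_symm v hv (fun x y => J x = J y) (fun _ _ h => h.symm),
    Finset.prod_lt_mul_symm v hv (fun x y => J x ≠ J y) (fun _ _ h => h.symm),
    ← Finset.prod_pow, ← Finset.prod_pow]
  congr 1
  · refine Finset.prod_congr rfl fun x _ => ?_
    congr 1
    rw [← hm x, ← Finset.card_erase_of_mem (a := x) (by simp)]
    congr 1
    ext y
    simp [eq_comm]
  · refine Finset.prod_congr rfl fun x _ => ?_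
    congr 1
    rw [← hm x, ← Finset.card_compl]
    congr 1
    ext y
    simp only [Finset.mem_filter, Finset.mem_univ, true_and, Finset.mem_compl]
    constructor
    · rintro ⟨_, h⟩ h'
      exact h h'.symm
    · intro h
      exact ⟨fun e => h (by rw [e]), fun e => h e.symm⟩

theorem ZMod.val_add_one_eq_ite {g : ℕ} [NeZero g] (k : ZMod g) :
    (k + 1).val = if k = -1 then 0 else k.val + 1 := by
  split_ifs with h
  · simp [h]
  · have hk := ZMod.val_lt k
    have hne : k.val + 1 ≠ g := by
      intro h'
      apply h
      have : ((k.val + 1 : ℕ) : ZMod g) = 0 := by rw [h']; simp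
      rw [Nat.cast_add, ZMod.natCast_zmod_val, Nat.cast_one] at this
      exact eq_neg_of_add_eq_zero_left this
    have : k + 1 = ((k.val + 1 : ℕ) : ZMod g) := by
      rw [Nat.cast_add, ZMod.natCast_zmod_val, Nat.cast_one]
    rw [this, ZMod.val_natCast, Nat.mod_eq_of_lt (by omega)]

theorem ZMod.val_neg_one_add_one (g : ℕ) [NeZero g] : (-1 : ZMod g).val + 1 = g := by
  obtain ⟨k, rfl⟩ := Nat.exists_eq_succ_of_ne_zero (NeZero.ne g)
  rw [ZMod.val_neg_one]

/-- For m > 0 the total exponent is congruent mod 2 to m + W(m - 1): this is W for m even and 1 for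
m odd. For m = 0 the truncated m - 1 hides W, hence `h0`. -/
theorem neg_one_pow_mul_eq_ite (g m W : ℕ) (hg : 0 < g) (h0 : m = 0 → W = 0) :
    (-1 : ℤˣ) ^ (g * m) * ((((-1 : ℤˣ) ^ W) ^ (m - 1)) * (((-1 : ℤˣ) ^ m) ^ (g * m - m))) =
      if Even m ∧ Even W then 1 else -1 := by
  rcases Nat.eq_zero_or_pos m with hm | hm
  · simp [hm, h0 hm]
  obtain ⟨g, rfl⟩ : ∃ k, g = k + 1 := ⟨g - 1, by omega⟩
  obtain ⟨m, rfl⟩ : ∃ k, m = k + 1 := ⟨m - 1, by omega⟩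
  have : (g + 1) * (m + 1) - (m + 1) = g * (m + 1) := by
    rw [Nat.add_mul, one_mul, Nat.add_sub_cancel]
  rw [this, Nat.add_sub_cancel, ← pow_mul, ← pow_mul, ← pow_add, ← pow_add]
  by_cases h1 : Even m <;> by_cases h2 : Even W <;> by_cases h3 : Even g <;>
    simp [h1, h2, h3, Nat.even_add_one, parity_simps]

/-- The sign of a permutation which shifts the fibres of `J` cyclically and preserves the cyclic
order, given by `I`, of each fibre. -/
theorem Equiv.Perm.exists_sign_eq_of_cyclic_fibres {α : Type*} [Fintype α] [DecidableEq α]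
    (σ : Equiv.Perm α) (g P h : ℕ) [NeZero g] (J : α → ZMod g) (I δ : α → ℕ)
    (hI : ∀ x, I x < P) (hinj : ∀ x y, J x = J y → I x = I y → x = y) (hδ : ∀ x, δ x ≤ 1)
    (hJσ : ∀ x, J (σ x) = J x + 1)
    (hIσ : ∀ x, I (σ x) = (I x + δ x + if J x = -1 then h else 0) % P) :
    ∃ m W : ℕ, Fintype.card α = g * m ∧ P * W = (∑ x, δ x) + h * m ∧
      (-1) ^ Fintype.card α * Equiv.Perm.sign σ = if Even m ∧ Even W then 1 else -1 := by
  -- The new coordinate before reduction mod P; `X x / P` is the winding number of the step from x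
  -- around its fibre.
  set X : α → ℕ := fun x => I x + δ x + if J x = -1 then h else 0 with hX
  let m := Finset.card {x | J x = 0}
  have hblock : ∀ j : ZMod g, Finset.card {x | J x = j} = m := by
    have hstep : ∀ j : ZMod g, Finset.card {x | J x = j + 1} = Finset.card {x | J x = j} := by
      intro j
      symm
      refine Finset.card_bij (fun x _ => σ x) ?_ ?_ ?_
      · intro x hx
        simp only [Finset.mem_filter, Finset.mem_univ, true_and] at hx ⊢
        rw [hJσ, hx]
      · intro x _ y _ hxy
        exact σ.injective hxy
      · intro y hy
        simp only [Finset.mem_filter, Finset.mem_univ, true_and] at hy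
        refine ⟨σ.symm y, ?_, by simp⟩
        have := hJσ (σ.symm y)
        rw [Equiv.apply_symm_apply, hy] at this
        simpa using this.symm
    have hnat : ∀ n : ℕ, Finset.card {x | J x = (n : ZMod g)} = m := by
      intro n
      induction n with
      | zero => simp [m]
      | succ n ih => rw [Nat.cast_add, Nat.cast_one, hstep, ih]
    intro j
    have := hnat j.val
    rwa [ZMod.natCast_zmod_val] at this
  have hcard : Fintype.card α = g * m := by
    have := Finset.card_eq_sum_card_fiberwise (f := J) (s := Finset.univ) (t := Finset.univ)
      (fun _ _ => by simp)
    rw [← Finset.card_univ, this]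
    simp [hblock]
  -- The total winding. Summing X = P · (X / P) + I ∘ σ over all points, the sums of I and I ∘ σ
  -- cancel.
  let W := ∑ x, X x / P
  have hW : P * W = (∑ x, δ x) + h * m := by
    have h1 : ∑ x, X x = P * W + ∑ x, I x := by
      rw [← Equiv.sum_comp σ I, Finset.mul_sum, ← Finset.sum_add_distrib]
      refine Finset.sum_congr rfl fun x _ => ?_
      rw [hIσ]
      exact (Nat.div_add_mod _ _).symm
    have h2 : ∑ x, X x = (∑ x, I x) + (∑ x, δ x) + h * m := by
      rw [hX, Finset.sum_add_distrib, Finset.sum_add_distrib, ← Finset.sum_filter,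
        Finset.sum_const, hblock, smul_eq_mul, mul_comm m]
    omega
  refine ⟨m, W, hcard, hW, ?_⟩
  -- Lexicographic order: first the fibre, then the position in it.
  let v : α → ℕ := fun x => (J x).val * P + I x
  have hvlt : ∀ x y, v x < v y ↔ (J x).val < (J y).val ∨ J x = J y ∧ I x < I y := by
    intro x y
    have hx := hI x
    have hy := hI y
    rcases lt_trichotomy (J x).val (J y).val with hlt | heq | hgt
    · simp only [hlt, true_or, iff_true, v]
      nlinarith [Nat.mul_le_mul_right P hlt]
    · have heq' := ZMod.val_injective g heq
      simp [v, heq']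
    · have : J x ≠ J y := fun h => by simp [h] at hgt
      simp only [this, false_and, or_false, not_lt.2 hgt.le, iff_false, not_lt, v]
      nlinarith [Nat.mul_le_mul_right P hgt]
  have hv : Function.Injective v := by
    intro x y hxy
    have h1 := (hvlt x y).not.1 (by omega)
    have h2 := (hvlt y x).not.1 (by omega)
    push Not at h1 h2
    have hJ : J x = J y := ZMod.val_injective g (le_antisymm h2.1 h1.1)
    exact hinj x y hJ (le_antisymm (h2.2 hJ.symm) (h1.2 hJ))
  -- Within a fibre, the unreduced coordinates keep their order and differ by less than P, so the
  -- winding numbers differ by 0 or 1, and a pair is inverted exactly when they differ by 1. Between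
  -- fibres, only the passage from fibre -1 to fibre 0 inverts.
  have key : ∀ x y, v x < v y → (if v (σ x) < v (σ y) then 1 else -1 : ℤˣ) =
      if J x = J y then (-1) ^ (X x / P) * (-1) ^ (X y / P) else
        (if J x = -1 then -1 else 1) * (if J y = -1 then -1 else 1) := by
    intro x y hxy
    rw [hvlt] at hxy
    have hxy' : x ≠ y := by
      rintro rfl
      simp at hxy
    by_cases hJ : J x = J y
    · have hIxy : I x < I y := by simpa [hJ] using hxy
      have hJ' : J (σ x) = J (σ y) := by rw [hJσ, hJσ, hJ]
      have hne : X x % P ≠ X y % P := by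
        rw [← hIσ, ← hIσ]
        exact fun h' => hxy' (σ.injective (hinj _ _ hJ' h'))
      have hX1 : X x ≤ X y ∧ X y ≤ X x + P := by
        have := hδ x
        have := hδ y
        have := hI y
        simp only [hX, hJ]
        omega
      have hP : 0 < P := lt_of_le_of_lt (Nat.zero_le _) (hI x)
      have hX2 : X x < X y := lt_of_le_of_ne hX1.1 fun h' => hne (by rw [h'])
      have hX3 : X y < X x + P := lt_of_le_of_ne hX1.2 fun h' => hne (by rw [h']; simp)
      have hcond : v (σ x) < v (σ y) ↔ X x % P < X y % P := by
        rw [hvlt, hJ', hIσ, hIσ]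
        simp [hX]
      simp only [hcond, hJ, if_true]
      have hx1 := Nat.div_add_mod (X x) P
      have hy1 := Nat.div_add_mod (X y) P
      have hx2 := Nat.mod_lt (X x) hP
      have hy2 := Nat.mod_lt (X y) hP
      have hq1 : X x / P ≤ X y / P := Nat.div_le_div_right hX2.le
      have hq2 : X y / P ≤ X x / P + 1 := by
        rw [← Nat.add_div_right _ hP]
        exact Nat.div_le_div_right hX3.le
      rcases (by omega : X y / P = X x / P ∨ X y / P = X x / P + 1) with hq | hq
      · rw [hq] at hy1 ⊢
        rw [if_pos (by omega), ← mul_pow]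
        simp
      · rw [hq, mul_add] at hy1
        rw [hq, if_neg (by omega), pow_succ, ← mul_assoc, ← mul_pow]
        simp
    · have hlt : (J x).val < (J y).val := by simpa [hJ] using hxy
      have hJ' : J (σ x) ≠ J (σ y) := by
        rw [hJσ, hJσ]
        exact fun h' => hJ (add_right_cancel h')
      have hcond : v (σ x) < v (σ y) ↔ (J x + 1).val < (J y + 1).val := by
        rw [hvlt, ← hJσ, ← hJσ]
        simp [hJ']
      simp only [hcond, hJ, if_false, ZMod.val_add_one_eq_ite]
      by_cases hx : J x = -1
      · have h1 := ZMod.val_lt (J y)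
        have h2 := ZMod.val_add_one_eq_ite (J y)
        have h3 : (J x).val + 1 = g := by rw [hx, ZMod.val_neg_one_add_one]
        omega
      · by_cases hy : J y = -1 <;> simp [hx, hy, hlt]
  rw [σ.sign_eq_of_fibres v hv J (fun x => (-1) ^ (X x / P)) (fun x => if J x = -1 then -1 else 1)
    key m (fun x => hblock _), Finset.prod_pow_eq_pow_sum, ← Finset.prod_filter,
    Finset.prod_const, hblock, hcard]
  refine neg_one_pow_mul_eq_ite g m W (NeZero.pos g) fun hm => ?_
  have hempty : IsEmpty α := Fintype.card_eq_zero_iff.1 (by rw [hcard, hm, mul_zero])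
  simp [W]

/-! ### The sign of a permutation of `ZMod p` with displacements 0, a, b. -/

theorem ZMod.intCast_mul_natCast_eq_zero_iff {p : ℕ} (hp : 0 < p) (c : ℕ) (i : ℤ) :
    (i : ZMod p) * (c : ZMod p) = 0 ↔ ((p / Nat.gcd c p : ℕ) : ℤ) ∣ i := by
  have hg : 0 < Nat.gcd c p := Nat.gcd_pos_of_pos_right _ hp
  obtain ⟨c', hc⟩ := Nat.gcd_dvd_left c p
  obtain ⟨p', hp'⟩ := Nat.gcd_dvd_right c p
  have hcop : Nat.Coprime c' p' := by
    have := Nat.coprime_div_gcd_div_gcd (m := c) (n := p) hg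
    rwa [Nat.div_eq_of_eq_mul_right hg hc, Nat.div_eq_of_eq_mul_right hg hp'] at this
  rw [Nat.div_eq_of_eq_mul_right hg hp', ← Int.cast_natCast (n := c), ← Int.cast_mul,
    ZMod.intCast_zmod_eq_zero_iff_dvd]
  generalize Nat.gcd c p = g at *
  subst hc hp'
  have hg' : (g : ℤ) ≠ 0 := by exact_mod_cast hg.ne'
  push_cast
  rw [mul_left_comm, mul_dvd_mul_iff_left hg']
  exact ⟨fun h => (Nat.isCoprime_iff_coprime.2 hcop.symm).dvd_of_dvd_mul_right h,
    fun h => h.mul_right _⟩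

theorem ZMod.exists_eq_natCast_mul {p : ℕ} [NeZero p] (c : ℕ) (x : ZMod p)
    (hx : ZMod.castHom (Nat.gcd_dvd_right c p) (ZMod (Nat.gcd c p)) x = 0) :
    ∃ i < p / Nat.gcd c p, x = (i : ZMod p) * (c : ZMod p) := by
  have hp := NeZero.pos p
  have hP : 0 < p / Nat.gcd c p :=
    Nat.div_pos (Nat.gcd_le_right _ hp) (Nat.gcd_pos_of_pos_right _ hp)
  have hval : Nat.gcd c p ∣ x.val := by
    rw [← ZMod.natCast_eq_zero_iff, ← hx, ← ZMod.natCast_zmod_val x, map_natCast,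
      ZMod.natCast_zmod_val]
  obtain ⟨q, hq⟩ := hval
  let t : ℤ := Nat.gcdA c p * q
  have hxt : x = (t : ZMod p) * (c : ZMod p) := by
    rw [← ZMod.natCast_zmod_val x, hq]
    have := congrArg (Int.cast : ℤ → ZMod p) (Nat.gcd_eq_gcd_ab c p)
    push_cast at this
    rw [ZMod.natCast_self, zero_mul, add_zero] at this
    push_cast [t]
    rw [this]
    ring
  have hP' : (0 : ℤ) < ((p / Nat.gcd c p : ℕ) : ℤ) := by exact_mod_cast hP
  have h0 := Int.emod_nonneg t hP'.ne'
  refine ⟨(t % ((p / Nat.gcd c p : ℕ) : ℤ)).toNat, ?_, ?_⟩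
  · have := Int.emod_lt_of_pos t hP'
    omega
  · have h1 : (((t % ((p / Nat.gcd c p : ℕ) : ℤ)).toNat : ℕ) : ZMod p) =
        ((t % ((p / Nat.gcd c p : ℕ) : ℤ) : ℤ) : ZMod p) := by
      rw [← Int.cast_natCast, Int.toNat_of_nonneg h0]
    rw [h1, hxt, ← sub_eq_zero, ← sub_mul, ← Int.cast_sub,
      ZMod.intCast_mul_natCast_eq_zero_iff hp]
    exact Int.dvd_self_sub_emod

/-- The sign of a permutation `τ` of `ZMod p`, each of whose displacements is `0`, `a` or `b`,
depends only on the numbers `r` and `s` of displacements `a` and `b`. -/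
theorem ZMod.neg_one_pow_mul_sign_of_displacements {p a b : ℕ} [NeZero p] (hab : a ≤ b)
    (hcop : Nat.Coprime a b) (f : ZMod p → Fin 3) (τ : Equiv.Perm (ZMod p))
    (hτ : ∀ x, τ x = x + ((![0, a, b] (f x) : ℕ) : ZMod p)) (r s : ℕ)
    (hr : Finset.card {x | f x = 1} = r) (hs : Finset.card {x | f x = 2} = s) :
    (-1 : ℤˣ) ^ (r + s) * Equiv.Perm.sign τ =
      if Even r ∧ Even s ∧ p ∣ r / 2 * a + s / 2 * b then 1 else -1 := by
  have hp := NeZero.pos p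
  obtain ⟨c, rfl⟩ := Nat.exists_eq_add_of_le hab
  set g := Nat.gcd c p
  set P := p / g
  have hgpos : 0 < g := Nat.gcd_pos_of_pos_right _ hp
  have : NeZero g := ⟨hgpos.ne'⟩
  have hPpos : 0 < P := Nat.div_pos (Nat.gcd_le_right _ hp) hgpos
  let π := ZMod.castHom (Nat.gcd_dvd_right c p) (ZMod g)
  have hag : Nat.Coprime a g := by
    refine Nat.Coprime.coprime_dvd_right (Nat.gcd_dvd_left c p) ?_
    simpa using hcop
  have hinv : (a : ZMod g) * (a : ZMod g)⁻¹ = 1 := ZMod.coe_mul_inv_eq_one a hag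
  have hπc : π (c : ZMod p) = 0 := by
    rw [map_natCast, ZMod.natCast_eq_zero_iff]
    exact Nat.gcd_dvd_left c p
  -- The coset of x modulo the subgroup generated by c = b - a, in units of a, which is invertible
  -- mod g since g ∣ b - a and gcd(a, b) = 1. Both displacements a and b raise J by 1.
  let J : ZMod p → ZMod g := fun x => π x * (a : ZMod g)⁻¹
  have hπJ : ∀ x, π x = J x * a := fun x => by
    simp only [J]
    rw [mul_assoc, mul_comm _ (a : ZMod g), hinv, mul_one]
  -- Coordinates x = J·a + I·c: displacement a keeps I and displacement b raises it by 1, except for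
  -- the wrap-around of J.
  have hcoord : ∀ x : ZMod p, ∃ i < P, x - ((J x).val : ZMod p) * a = (i : ZMod p) * c := by
    intro x
    apply ZMod.exists_eq_natCast_mul
    change π _ = 0
    rw [map_sub, map_mul, map_natCast, map_natCast, ZMod.natCast_zmod_val, hπJ, sub_self]
  choose I hI hIx using hcoord
  -- One turn through all the fibres adds g·a, which is a multiple of c; h is the resulting
  -- correction to I when J passes from -1 to 0.
  obtain ⟨h, -, hh⟩ : ∃ h < P, (g : ZMod p) * a = (h : ZMod p) * c := by
    apply ZMod.exists_eq_natCast_mul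
    change π _ = 0
    rw [map_mul, map_natCast, ZMod.natCast_self, zero_mul]
  have huniq : ∀ i j : ℕ, (i : ZMod p) * c = (j : ZMod p) * c → j < P → j = i % P := by
    intro i j hij hj
    have h1 : (((i : ℤ) - (j : ℤ) : ℤ) : ZMod p) * c = 0 := by
      push_cast
      rw [sub_mul, hij, sub_self]
    rw [ZMod.intCast_mul_natCast_eq_zero_iff hp] at h1
    have h2 := (Nat.modEq_iff_dvd.2 h1)
    rw [← h2, Nat.mod_eq_of_lt hj]
  have hJmem : ∀ x, f x ≠ 0 → J (τ x) = J x + 1 := by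
    intro x hx
    have : π (τ x) = π x + a := by
      rw [hτ, map_add, map_natCast]
      congr 1
      have h3 : f x = 1 ∨ f x = 2 := by
        generalize f x = k at *
        fin_cases k <;> simp at *
      have hc0 : (c : ZMod g) = 0 := by simpa using hπc
      rcases h3 with h3 | h3 <;> simp [h3, hc0]
    simp only [J, this, add_mul, hinv]
  have hmem : ∀ x, f (τ x) ≠ 0 ↔ f x ≠ 0 := by
    have hfix : ∀ x, f x = 0 → τ x = x := fun x hx => by simp [hτ, hx]
    have hback : ∀ x, f (τ x) = 0 → f x = 0 := by
      intro x hx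
      have : τ x = x := τ.injective (hfix _ hx)
      rwa [this] at hx
    intro x
    refine not_congr ⟨hback x, fun hx => ?_⟩
    rw [hfix x hx, hx]
  -- Points labelled 0 are fixed, so the sign may be computed on the remaining r + s points, where
  -- every step shifts J.
  let σ := τ.subtypePerm (p := fun x => f x ≠ 0) hmem
  have hsign : Equiv.Perm.sign σ = Equiv.Perm.sign τ := by
    apply Equiv.Perm.sign_subtypePerm
    intro x hx h0
    exact hx (by simp [hτ, h0])
  have hcard : Fintype.card {x // f x ≠ 0} = r + s := by
    rw [Fintype.card_subtype, ← hr, ← hs, ← Finset.card_union_of_disjoint]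
    · congr 1
      ext x
      simp only [Finset.mem_filter, Finset.mem_univ, true_and, Finset.mem_union]
      generalize f x = k
      fin_cases k <;> simp
    · rw [Finset.disjoint_left]
      simp +contextual
  let δ : {x // f x ≠ 0} → ℕ := fun x => if f x = 2 then 1 else 0
  have hδsum : ∑ x, δ x = s := by
    rw [← hs, Finset.card_filter, ← Finset.sum_subtype (Finset.univ.filter fun x => f x ≠ 0)
      (by simp) (fun x => if f x = 2 then 1 else 0), Finset.sum_filter]
    refine Finset.sum_congr rfl fun x _ => ?_
    generalize f x = k
    fin_cases k <;> simp
  have hinj : ∀ x y : {x // f x ≠ 0}, J x = J y → I x = I y → x = y := by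
    intro x y hJ hIxy
    have hx := hIx x
    have hy := hIx y
    rw [hJ, hIxy, ← hy] at hx
    exact Subtype.ext (sub_left_injective hx)
  have hδ : ∀ x, δ x ≤ 1 := by
    intro x
    simp only [δ]
    split_ifs <;> simp
  have hJσ : ∀ x, J (σ x) = J x + 1 := by
    intro x
    exact hJmem x x.2
  have hIσ : ∀ x : {x // f x ≠ 0}, I (σ x) = (I x + δ x + if J x = -1 then h else 0) % P := by
    intro x
    refine huniq _ _ ?_ (hI _)
    have hx := hIx x
    have hτx := hIx (τ x)
    have hJx := hJmem x x.2
    change _ = (I (τ x) : ZMod p) * c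
    rw [← hτx, hJx, ZMod.val_add_one_eq_ite, hτ]
    have hstep : ((![0, a, a + c] (f x) : ℕ) : ZMod p) = a + δ x * c := by
      have := x.2
      simp only [δ]
      generalize f x = k at *
      fin_cases k <;> simp at *
    rw [hstep]
    by_cases hj : J x = -1
    · have hval' : (((J x).val : ℕ) : ZMod p) = g - 1 := by
        rw [hj, eq_sub_iff_add_eq]
        exact_mod_cast congrArg (Nat.cast (R := ZMod p)) (ZMod.val_neg_one_add_one g)
      rw [hval'] at hx
      simp only [hj, if_true]
      push_cast
      linear_combination -hx - hh
    · simp only [hj, if_false]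
      push_cast
      linear_combination -hx
  obtain ⟨m, W, h1, h2, h3⟩ := σ.exists_sign_eq_of_cyclic_fibres g P h (fun x => J x)
    (fun x => I x) δ (fun x => hI x) hinj hδ hJσ hIσ
  rw [hcard] at h1 h3
  rw [hsign] at h3
  rw [hδsum] at h2
  rw [h3]
  congr 1
  rw [eq_iff_iff]
  -- With r + s = g m and s + h m = P W, halving gives (r/2)a + (s/2)b = (m/2) g a + (s/2) c = (s/2
  -- + h m/2) c = P (W/2) c = 0 in `ZMod p`. The converse runs the same identities backwards.
  constructor
  · rintro ⟨⟨m', rfl⟩, ⟨W', rfl⟩⟩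
    have e1 : r + s = 2 * (g * m') := by rw [h1]; ring
    have e2 : s + 2 * (h * m') = 2 * (P * W') := by
      have : s + h * (m' + m') = P * (W' + W') := h2.symm
      linarith
    obtain ⟨s', rfl⟩ : ∃ k, s = 2 * k := ⟨s / 2, by omega⟩
    obtain ⟨r', rfl⟩ : ∃ k, r = 2 * k := ⟨r / 2, by omega⟩
    refine ⟨even_two_mul _, even_two_mul _, ?_⟩
    rw [Nat.mul_div_cancel_left _ two_pos, Nat.mul_div_cancel_left _ two_pos,
      ← ZMod.natCast_eq_zero_iff]
    have e3 : r' + s' = g * m' := by omega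
    have e4 : s' + h * m' = P * W' := by omega
    have e5 : (r' : ZMod p) + s' = g * m' := by exact_mod_cast congrArg (Nat.cast (R := ZMod p)) e3
    have e6 : (s' : ZMod p) + h * m' = P * W' := by
      exact_mod_cast congrArg (Nat.cast (R := ZMod p)) e4
    have e7 : (P : ZMod p) * c = 0 := by
      have := (ZMod.intCast_mul_natCast_eq_zero_iff hp c (P : ℤ)).2 dvd_rfl
      simpa using this
    push_cast
    linear_combination (a : ZMod p) * e5 + (c : ZMod p) * e6 + (m' : ZMod p) * hh + W' * e7
  · rintro ⟨⟨r', rfl⟩, ⟨s', rfl⟩, hd⟩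
    rw [← two_mul, ← two_mul, Nat.mul_div_cancel_left _ two_pos,
      Nat.mul_div_cancel_left _ two_pos, ← ZMod.natCast_eq_zero_iff] at hd
    push_cast at hd
    have e1 : g ∣ r' + s' := by
      have := congrArg π hd
      simp only [map_add, map_mul, map_natCast, map_zero] at this
      have hc0 : (c : ZMod g) = 0 := by simpa using hπc
      rw [hc0, add_zero, ← add_mul] at this
      rw [← ZMod.natCast_eq_zero_iff]
      push_cast
      calc ((r' : ZMod g) + s') = ((r' : ZMod g) + s') * (a * (a : ZMod g)⁻¹) := by
            rw [hinv, mul_one]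
        _ = 0 := by rw [← mul_assoc, this, zero_mul]
    obtain ⟨m', hm'⟩ := e1
    have e2 : m = 2 * m' := by
      apply Nat.eq_of_mul_eq_mul_left hgpos
      rw [← h1, mul_left_comm, ← hm']
      ring
    have e3 : P ∣ s' + h * m' := by
      have e5 : (r' : ZMod p) + s' = g * m' := by
        exact_mod_cast congrArg (Nat.cast (R := ZMod p)) hm'
      have : (((s' + h * m' : ℕ) : ℤ) : ZMod p) * c = 0 := by
        push_cast
        linear_combination hd - (a : ZMod p) * e5 - (m' : ZMod p) * hh
      rw [ZMod.intCast_mul_natCast_eq_zero_iff hp] at this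
      exact_mod_cast this
    obtain ⟨W', hW'⟩ := e3
    have e4 : W = 2 * W' := by
      apply Nat.eq_of_mul_eq_mul_left hPpos
      rw [h2, mul_left_comm, ← hW', e2]
      ring
    exact ⟨e2 ▸ even_two_mul _, e4 ▸ even_two_mul _⟩

/-! ### Existence of permutations with prescribed displacement counts. -/

/-- Multiplication by e takes values in the multiples of d = gcd(e, p), each attained equally often;
the case n = p shows that this is d times. -/
theorem ZMod.card_val_mul_lt {p : ℕ} [NeZero p] (e : ZMod p) (n : ℕ) (hn : n ≤ p)
    (hd : Nat.gcd e.val p ∣ n) : Finset.card {x : ZMod p | (e * x).val < n} = n := by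
  have hp := NeZero.pos p
  set d := Nat.gcd e.val p with hd_def
  have hdpos : 0 < d := Nat.gcd_pos_of_pos_right _ hp
  have hdp : d ∣ p := Nat.gcd_dvd_right _ _
  have hdvd : ∀ x : ZMod p, d ∣ (e * x).val := by
    intro x
    rw [ZMod.val_mul, Nat.dvd_mod_iff hdp]
    exact (Nat.gcd_dvd_left _ _).mul_right _
  obtain ⟨x₀, hx₀⟩ : ∃ x₀ : ZMod p, e * x₀ = (d : ZMod p) := by
    refine ⟨(Nat.gcdA e.val p : ZMod p), ?_⟩
    have := congrArg (Int.cast : ℤ → ZMod p) (Nat.gcd_eq_gcd_ab e.val p)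
    push_cast at this
    rw [ZMod.natCast_self, zero_mul, add_zero, ZMod.natCast_zmod_val] at this
    exact this.symm
  set κ := Finset.card {x : ZMod p | e * x = 0} with hκ
  have hfib : ∀ j : ℕ, Finset.card {x : ZMod p | e * x = ((d * j : ℕ) : ZMod p)} = κ := by
    intro j
    symm
    refine Finset.card_bij' (fun x _ => x + j * x₀) (fun x _ => x - j * x₀) ?_ ?_ ?_ ?_
    · intro x hx
      simp only [Finset.mem_filter, Finset.mem_univ, true_and] at hx ⊢
      push_cast
      linear_combination hx + (j : ZMod p) * hx₀
    · intro x hx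
      simp only [Finset.mem_filter, Finset.mem_univ, true_and] at hx ⊢
      push_cast at hx
      linear_combination hx - (j : ZMod p) * hx₀
    · simp
    · simp
  have hN : ∀ j : ℕ, d * j ≤ p →
      Finset.card {x : ZMod p | (e * x).val < d * j} = j * κ := by
    intro j
    induction j with
    | zero => simp
    | succ j ih =>
      intro hj
      have hj' : d * j < p := lt_of_lt_of_le (by nlinarith) hj
      rw [Nat.add_mul, one_mul, ← ih hj'.le, ← hfib j, ← Finset.card_union_of_disjoint]
      · congr 1
        ext x
        simp only [Finset.mem_filter, Finset.mem_univ, true_and, Finset.mem_union]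
        have h1 : e * x = ((d * j : ℕ) : ZMod p) ↔ (e * x).val = d * j := by
          rw [← (ZMod.val_injective p).eq_iff, ZMod.val_natCast, Nat.mod_eq_of_lt hj']
        rw [h1]
        obtain ⟨q, hq⟩ := hdvd x
        rw [hq, Nat.mul_lt_mul_left hdpos, Nat.mul_lt_mul_left hdpos,
          Nat.mul_right_inj hdpos.ne']
        omega
      · rw [Finset.disjoint_left]
        intro x
        simp only [Finset.mem_filter, Finset.mem_univ, true_and]
        intro hx hx'
        rw [hx', ZMod.val_natCast, Nat.mod_eq_of_lt hj'] at hx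
        exact lt_irrefl _ hx
  have hκd : κ = d := by
    obtain ⟨q, hq⟩ := hdp
    have h1 := hN q hq.ge
    rw [← hq, Finset.filter_true_of_mem (fun x _ => ZMod.val_lt _), Finset.card_univ,
      ZMod.card] at h1
    have hqpos : 0 < q := Nat.pos_of_ne_zero (by rintro rfl; omega)
    apply Nat.eq_of_mul_eq_mul_left hqpos
    rw [← h1, mul_comm q d, ← hq]
  obtain ⟨j, rfl⟩ := hd
  rw [hN j hn, hκd, mul_comm]

/-- An interval exchange. Bézout together with ra + sb = 0 gives e with ea = s and eb = -r. Moving x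
by a when ex lies in [0, r) and by b when it lies in [r, r + s) swaps these two adjacent intervals
for the coordinate ex. -/
theorem ZMod.exists_bijective_displacement {p a b : ℕ} [NeZero p] (hcop : Nat.Coprime a b)
    (r s : ℕ) (hrs : r + s ≤ p) (hdvd : p ∣ r * a + s * b) :
    ∃ f : ZMod p → Fin 3, Finset.card {x | f x = 1} = r ∧ Finset.card {x | f x = 2} = s ∧
      Function.Bijective fun x => x + ((![0, a, b] (f x) : ℕ) : ZMod p) := by
  obtain ⟨e, hea, heb⟩ : ∃ e : ZMod p, e * a = s ∧ e * b = -r := by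
    have h1 := congrArg (Int.cast : ℤ → ZMod p) (Nat.gcd_eq_gcd_ab a b)
    rw [Nat.Coprime.gcd_eq_one hcop] at h1
    rw [← ZMod.natCast_eq_zero_iff] at hdvd
    push_cast at h1 hdvd
    refine ⟨Nat.gcdA a b * s - Nat.gcdB a b * r, ?_, ?_⟩
    · linear_combination -(s : ZMod p) * h1 - (Nat.gcdB a b : ZMod p) * hdvd
    · linear_combination (r : ZMod p) * h1 + (Nat.gcdA a b : ZMod p) * hdvd
  have hgcd : ∀ n c : ℕ, e * c = n ∨ e * c = -n → Nat.gcd e.val p ∣ n := by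
    intro n c h
    have h1 : ((e.val * c : ℕ) : ZMod p) = e * c := by simp
    rcases h with h | h
    · rw [h, ZMod.natCast_eq_natCast_iff] at h1
      exact (((h1.of_dvd (Nat.gcd_dvd_right _ _)).dvd_iff dvd_rfl).1
        ((Nat.gcd_dvd_left _ _).mul_right _))
    · have h2 : ((e.val * c + n : ℕ) : ZMod p) = 0 := by
        rw [Nat.cast_add, h1, h, neg_add_cancel]
      rw [ZMod.natCast_eq_zero_iff] at h2
      exact (Nat.dvd_add_right ((Nat.gcd_dvd_left _ _).mul_right _)).1
        ((Nat.gcd_dvd_right _ _).trans h2)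
  have hdr := hgcd r b (Or.inr heb)
  have hds := hgcd s a (Or.inl hea)
  let f : ZMod p → Fin 3 := fun x =>
    if (e * x).val < r then 1 else if (e * x).val < r + s then 2 else 0
  refine ⟨f, ?_, ?_, ?_⟩
  · rw [← ZMod.card_val_mul_lt e r (by omega) hdr]
    congr 1
    ext x
    simp only [Finset.mem_filter, Finset.mem_univ, true_and, f]
    split_ifs <;> simp_all
  · have h1 := ZMod.card_val_mul_lt e r (by omega) hdr
    have h2 := ZMod.card_val_mul_lt e (r + s) hrs (dvd_add hdr hds)
    have h3 : Finset.card {x : ZMod p | (e * x).val < r + s} =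
        Finset.card {x : ZMod p | (e * x).val < r} + Finset.card {x | f x = 2} := by
      rw [← Finset.card_union_of_disjoint]
      · congr 1
        ext x
        simp only [Finset.mem_filter, Finset.mem_univ, true_and, Finset.mem_union, f]
        split_ifs <;> simp <;> omega
      · rw [Finset.disjoint_left]
        intro x
        simp only [Finset.mem_filter, Finset.mem_univ, true_and, f]
        intro hx
        simp [hx]
    omega
  · rw [← Finite.injective_iff_bijective]
    have hval : ∀ x, (e * (x + ((![0, a, b] (f x) : ℕ) : ZMod p))).val =
        if f x = 1 then (e * x).val + s else if f x = 2 then (e * x).val - r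
          else (e * x).val := by
      intro x
      have hx := ZMod.val_lt (e * x)
      have hcast : ((e * x).val : ZMod p) = e * x := ZMod.natCast_zmod_val _
      by_cases h1 : (e * x).val < r
      · have hf : f x = 1 := by simp [f, h1]
        have : e * (x + ((![0, a, b] (f x) : ℕ) : ZMod p)) = (((e * x).val + s : ℕ) : ZMod p) := by
          simp [hf, mul_add, hea]
        rw [this, ZMod.val_natCast, Nat.mod_eq_of_lt (by omega), if_pos hf]
      · by_cases h2 : (e * x).val < r + s
        · have hf : f x = 2 := by simp [f, h1, h2]
          have : e * (x + ((![0, a, b] (f x) : ℕ) : ZMod p)) =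
              (((e * x).val - r : ℕ) : ZMod p) := by
            rw [Nat.cast_sub (by omega), hcast]
            simp [hf, mul_add, heb, sub_eq_add_neg]
          rw [this, ZMod.val_natCast, Nat.mod_eq_of_lt (by omega), hf]
          simp
        · have hf : f x = 0 := by simp [f, h1, h2]
          simp [hf]
    -- The label of x is read off from the interval containing the image of x, so equal images force
    -- equal labels and hence equal points.
    have hfeq : ∀ x, f x = if (e * (x + ((![0, a, b] (f x) : ℕ) : ZMod p))).val < s then 2
        else if (e * (x + ((![0, a, b] (f x) : ℕ) : ZMod p))).val < r + s then 1 else 0 := by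
      intro x
      rw [hval]
      by_cases h1 : (e * x).val < r
      · have hf : f x = 1 := by simp [f, h1]
        simp [hf, h1]
      · by_cases h2 : (e * x).val < r + s
        · have hf : f x = 2 := by simp [f, h1, h2]
          have : (e * x).val - r < s := by omega
          simp [hf, this]
        · have hf : f x = 0 := by simp [f, h1, h2]
          have : ¬ (e * x).val < s := by omega
          simp [hf, this, h2]
    intro x y hxy
    have hf : f x = f y := by
      rw [hfeq x, hfeq y]
      simp only at hxy
      rw [hxy]
    simp only [hf] at hxy
    exact add_right_cancel hxy

/-! ### The product as a determinant, and the signs of its coefficients. -/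

theorem Matrix.det_of_single {n R : Type*} [Fintype n] [DecidableEq n] [CommRing R] (τ : n → n) :
    Matrix.det (Matrix.of fun i => (Pi.single (τ i) 1 : n → R)) =
      if h : Function.Bijective τ then
        ((Equiv.Perm.sign (Equiv.ofBijective τ h) : ℤ) : R) else 0 := by
  split_ifs with h
  · rw [← Matrix.det_permutation]
    congr 1
    ext i j
    simp [Equiv.Perm.permMatrix, PEquiv.toMatrix_apply, Pi.single_apply, eq_comm]
  · rw [← Finite.injective_iff_bijective] at h
    simp only [Function.Injective, not_forall] at h
    obtain ⟨i, j, hij, hne⟩ := h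
    refine Matrix.det_zero_of_row_eq hne ?_
    ext k
    simp [hij]

theorem Matrix.det_sum_smul_single {n ι R : Type*} [Fintype n] [DecidableEq n] [Fintype ι]
    [DecidableEq ι] [CommRing R] (c : ι → R) (d : ι → n → n) :
    Matrix.det (Matrix.of fun i => ∑ l, c l • (Pi.single (d l i) 1 : n → R)) =
      ∑ f : n → ι, (∏ i, c (f i)) *
        if h : Function.Bijective fun i => d (f i) i then
          ((Equiv.Perm.sign (Equiv.ofBijective _ h) : ℤ) : R) else 0 := by
  have h1 := (Matrix.detRowAlternating (n := n) (R := R)).toMultilinearMap.map_sum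
    (fun i l => c l • (Pi.single (d l i) 1 : n → R))
  refine h1.trans (Finset.sum_congr rfl fun f _ => ?_)
  rw [MultilinearMap.map_smul_univ, ← Matrix.det_of_single, smul_eq_mul]
  rfl

theorem ZMod.det_pow_val_mul_val_ne_zero {p : ℕ} [NeZero p] {ω : ℂ} (hω : IsPrimitiveRoot ω p) :
    Matrix.det (Matrix.of fun i t : ZMod p => ω ^ (i.val * t.val)) ≠ 0 := by
  obtain ⟨n, rfl⟩ := Nat.exists_eq_succ_of_ne_zero (NeZero.ne p)
  have : (Matrix.of fun i t : ZMod (n + 1) => ω ^ (i.val * t.val)) =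
      Matrix.vandermonde (fun i : Fin (n + 1) => ω ^ (i : ℕ)) := by
    ext i t
    exact pow_mul ω i.val t.val
  rw [this]
  refine Matrix.det_vandermonde_ne_zero_iff.2 fun i j hij => ?_
  exact Fin.ext (hω.pow_inj i.2 j.2 hij)

/-- The Fourier matrix V diagonalizes all cyclic shifts at once, and the factors of the product are
the eigenvalues; det V is a nonzero Vandermonde determinant and cancels. -/
theorem MvPolynomial.prod_eq_det_shift {p : ℕ} [NeZero p] {ω : ℂ} (hω : IsPrimitiveRoot ω p)
    (a b : ℕ) :
    ∏ j ∈ Finset.range p, (1 - MvPolynomial.C (ω ^ (j * a)) * MvPolynomial.X 0 -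
        MvPolynomial.C (ω ^ (j * b)) * MvPolynomial.X 1 : MvPolynomial (Fin 2) ℂ) =
      Matrix.det (Matrix.of fun i : ZMod p => ∑ l : Fin 3,
        (![1, -MvPolynomial.X 0, -MvPolynomial.X 1] l : MvPolynomial (Fin 2) ℂ) •
          (Pi.single (i + ((![0, a, b] l : ℕ) : ZMod p)) 1 : ZMod p → MvPolynomial (Fin 2) ℂ)) := by
  set V : Matrix (ZMod p) (ZMod p) ℂ := Matrix.of fun i t => ω ^ (i.val * t.val) with hV
  set D : ZMod p → MvPolynomial (Fin 2) ℂ := fun t =>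
    1 - MvPolynomial.C (ω ^ (t.val * a)) * MvPolynomial.X 0 -
        MvPolynomial.C (ω ^ (t.val * b)) * MvPolynomial.X 1 with hD
  set M := Matrix.of fun i : ZMod p => ∑ l : Fin 3,
        (![1, -MvPolynomial.X 0, -MvPolynomial.X 1] l : MvPolynomial (Fin 2) ℂ) •
          (Pi.single (i + ((![0, a, b] l : ℕ) : ZMod p)) 1 : ZMod p → MvPolynomial (Fin 2) ℂ)
    with hM
  have hω1 : ω ^ p = 1 := hω.pow_eq_one
  have hshift : ∀ (i t : ZMod p) (c : ℕ), V (i + c) t = V i t * ω ^ (t.val * c) := by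
    intro i t c
    simp only [hV, Matrix.of_apply, ← pow_add]
    refine pow_eq_pow_of_modEq ?_ hω1
    rw [← ZMod.natCast_eq_natCast_iff]
    push_cast
    simp only [ZMod.natCast_zmod_val]
    ring
  have hmul : M * V.map MvPolynomial.C = V.map MvPolynomial.C * Matrix.diagonal D := by
    refine Matrix.ext fun i t => ?_
    rw [Matrix.mul_diagonal, Matrix.mul_apply]
    simp only [hM, Matrix.of_apply, Finset.sum_apply, Pi.smul_apply, smul_eq_mul, Finset.sum_mul,
      Matrix.map_apply]
    rw [Finset.sum_comm]
    simp only [Pi.single_apply, mul_ite, mul_one, mul_zero, ite_mul, zero_mul,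
      Finset.sum_ite_eq', Finset.mem_univ, if_true, Fin.sum_univ_three]
    simp only [Matrix.cons_val_zero, Matrix.cons_val_one, Matrix.cons_val, hshift, hD, map_mul]
    simp only [mul_zero, pow_zero, map_one]
    ring
  have hdet := congrArg Matrix.det hmul
  rw [Matrix.det_mul, Matrix.det_mul, Matrix.det_diagonal, mul_comm] at hdet
  have hne : (V.map MvPolynomial.C : Matrix _ _ (MvPolynomial (Fin 2) ℂ)).det ≠ 0 := by
    have h1 := (MvPolynomial.C (σ := Fin 2) (R := ℂ)).map_det V
    have h2 : (V.map MvPolynomial.C : Matrix _ _ (MvPolynomial (Fin 2) ℂ)) =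
      (MvPolynomial.C (σ := Fin 2) (R := ℂ)).mapMatrix V := rfl
    rw [h2, ← h1, Ne, MvPolynomial.C_eq_zero]
    exact ZMod.det_pow_val_mul_val_ne_zero hω
  rw [mul_left_cancel₀ hne hdet]
  refine Finset.prod_bij' (fun j _ => (j : ZMod p)) (fun t _ => t.val) ?_ ?_ ?_ ?_ ?_
  · simp
  · intro t _
    simpa using ZMod.val_lt t
  · intro j hj
    exact ZMod.val_cast_of_lt (Finset.mem_range.1 hj)
  · simp
  · intro j hj
    simp only [hD, ZMod.val_cast_of_lt (Finset.mem_range.1 hj)]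

/-- N is the number of admissible labellings; every one contributes the same sign, so the
coefficient vanishes only if there are none. -/
theorem MvPolynomial.coeff_prod_one_sub {p a b : ℕ} [NeZero p] {ω : ℂ} (hω : IsPrimitiveRoot ω p)
    (hab : a ≤ b) (hcop : Nat.Coprime a b) (α : Fin 2 →₀ ℕ) :
    ∃ N : ℕ, (0 < N ↔ α 0 + α 1 ≤ p ∧ p ∣ α 0 * a + α 1 * b) ∧
      (∏ j ∈ Finset.range p, (1 - MvPolynomial.C (ω ^ (j * a)) * MvPolynomial.X 0 -
        MvPolynomial.C (ω ^ (j * b)) * MvPolynomial.X 1 : MvPolynomial (Fin 2) ℂ)).coeff α =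
      (if Even (α 0) ∧ Even (α 1) ∧ p ∣ α 0 / 2 * a + α 1 / 2 * b then 1 else -1) * (N : ℂ) := by
  classical
  let A : Finset (ZMod p → Fin 3) := {f | (Finset.card {x | f x = 1} = α 0 ∧
    Finset.card {x | f x = 2} = α 1) ∧
    Function.Bijective fun x => x + ((![0, a, b] (f x) : ℕ) : ZMod p)}
  refine ⟨A.card, ?_, ?_⟩
  · rw [Finset.card_pos]
    constructor
    · rintro ⟨f, hf⟩
      simp only [A, Finset.mem_filter, Finset.mem_univ, true_and] at hf
      obtain ⟨⟨h1, h2⟩, h3⟩ := hf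
      constructor
      · rw [← h1, ← h2, ← Finset.card_union_of_disjoint]
        · exact (Finset.card_le_univ _).trans (ZMod.card p).le
        · rw [Finset.disjoint_left]
          simp +contextual
      · have h4 := Function.Bijective.sum_comp h3 (fun x : ZMod p => x)
        rw [Finset.sum_add_distrib, add_eq_left] at h4
        rw [← Finset.sum_fiberwise' Finset.univ f
          (fun l => ((![0, a, b] l : ℕ) : ZMod p))] at h4
        simp only [Fin.sum_univ_three, Finset.sum_const, h1, h2] at h4
        rw [← ZMod.natCast_eq_zero_iff]
        simpa using h4
    · rintro ⟨h1, h2⟩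
      obtain ⟨f, hf1, hf2, hf3⟩ := ZMod.exists_bijective_displacement hcop _ _ h1 h2
      exact ⟨f, Finset.mem_filter.2 ⟨Finset.mem_univ _, ⟨hf1, hf2⟩, hf3⟩⟩
  · rw [MvPolynomial.prod_eq_det_shift hω, Matrix.det_sum_smul_single, MvPolynomial.coeff_sum,
      Finset.card_filter, Nat.cast_sum, Finset.mul_sum]
    refine Finset.sum_congr rfl fun f _ => ?_
    have hprod : ∏ i, (![1, -MvPolynomial.X 0, -MvPolynomial.X 1] (f i) : MvPolynomial (Fin 2) ℂ) =
        MvPolynomial.monomial (Finsupp.single 0 (Finset.card {x | f x = 1}) +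
          Finsupp.single 1 (Finset.card {x | f x = 2}))
          ((-1) ^ (Finset.card {x | f x = 1} + Finset.card {x | f x = 2})) := by
      rw [← Finset.prod_fiberwise' Finset.univ f
          (fun l => (![1, -MvPolynomial.X 0, -MvPolynomial.X 1] l : MvPolynomial (Fin 2) ℂ))]
      simp only [Fin.prod_univ_three, Finset.prod_const]
      simp only [Matrix.cons_val_zero, Matrix.cons_val_one, Matrix.cons_val, one_pow, one_mul]
      rw [neg_pow, neg_pow (MvPolynomial.X 1 : MvPolynomial (Fin 2) ℂ), MvPolynomial.X_pow_eq_monomial,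
        MvPolynomial.X_pow_eq_monomial, mul_mul_mul_comm, MvPolynomial.monomial_mul, ← pow_add,
        one_mul, ← MvPolynomial.C_1, ← MvPolynomial.C_neg, ← MvPolynomial.C_pow,
        MvPolynomial.C_mul_monomial, mul_one]
    have hα : Finsupp.single 0 (Finset.card {x | f x = 1}) +
          Finsupp.single 1 (Finset.card {x | f x = 2}) = α ↔
          Finset.card {x | f x = 1} = α 0 ∧ Finset.card {x | f x = 2} = α 1 := by
      rw [Finsupp.ext_iff, Fin.forall_fin_two]
      simp
    rw [hprod]
    by_cases hbij : Function.Bijective fun x => x + ((![0, a, b] (f x) : ℕ) : ZMod p)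
    · rw [dif_pos hbij, mul_comm, ← map_intCast (MvPolynomial.C (σ := Fin 2) (R := ℂ)),
        MvPolynomial.coeff_C_mul, MvPolynomial.coeff_monomial]
      simp only [hα, hbij, and_true]
      by_cases h1 : Finset.card {x | f x = 1} = α 0 ∧ Finset.card {x | f x = 2} = α 1
      · have h2 := congrArg (fun u : ℤˣ => ((u : ℤ) : ℂ))
          (ZMod.neg_one_pow_mul_sign_of_displacements hab hcop f
            (Equiv.ofBijective _ hbij) (fun _ => rfl) _ _ h1.1 h1.2)
        rw [if_pos h1, if_pos h1, h1.1, h1.2, Nat.cast_one, mul_one, mul_comm]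
        simp only [apply_ite (fun u : ℤˣ => ((u : ℤ) : ℂ))] at h2
        push_cast at h2
        exact h2
      · rw [if_neg h1, if_neg h1]
        simp
    · rw [dif_neg hbij, mul_zero, MvPolynomial.coeff_zero]
      simp only [hbij, and_false, if_false, Nat.cast_zero, mul_zero]

/-! ### Eigenvalues of the coefficient matrix of the cyclic group. -/

open Classical in
theorem Matrix.countP_roots_charpoly_diagonal {n R : Type*} [Fintype n] [DecidableEq n]
    [CommRing R] [IsDomain R] (d : n → R) (Q : R → Prop) :
    (Matrix.diagonal d).charpoly.roots.countP Q = Finset.card {i | Q (d i)} := by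
  have h : ∏ i, (Polynomial.X - Polynomial.C (d i)) =
      ((Finset.univ.val.map d).map fun a => Polynomial.X - Polynomial.C a).prod := by
    rw [Multiset.map_map]
    rfl
  rw [Matrix.charpoly_diagonal, h, Polynomial.roots_multiset_prod_X_sub_C, Multiset.countP_map]
  rfl

/-- A polynomial in the products zᵢ z̄ᵢ contains only monomials with equal exponents in z and z̄;
this makes the coefficient matrix diagonal. -/
theorem MvPolynomial.coeff_bind₁_X_mul_X {R ι : Type*} [CommSemiring R] [Fintype ι]
    (F : MvPolynomial ι R) (m n : ι → ℕ) [Decidable (m = n)] :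
    (MvPolynomial.bind₁ (fun i => (X (Sum.inl i) * X (Sum.inr i) : MvPolynomial (ι ⊕ ι) R)) F).coeff
      (Finsupp.equivFunOnFinite.symm (Sum.elim m n)) =
      if m = n then F.coeff (Finsupp.equivFunOnFinite.symm m) else 0 := by
  classical
  induction F using MvPolynomial.induction_on' with
  | add f g hf hg =>
    rw [map_add, coeff_add, hf, hg, coeff_add]
    split_ifs <;> simp
  | monomial u c =>
    have h1 : MvPolynomial.bind₁ (fun i => (X (Sum.inl i) * X (Sum.inr i) :
        MvPolynomial (ι ⊕ ι) R)) (monomial u c) =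
        monomial (Finsupp.equivFunOnFinite.symm (Sum.elim u u)) c := by
      rw [bind₁_monomial, monomial_eq, Finsupp.prod_fintype _ _ (by simp), Fintype.prod_sum_type,
        ← Finset.prod_mul_distrib]
      congr 1
      rw [Finset.prod_subset (Finset.subset_univ _)]
      · refine Finset.prod_congr rfl fun i _ => ?_
        simp [mul_pow]
      · intro i _ hi
        simp [Finsupp.notMem_support_iff.1 hi]
    rw [h1, coeff_monomial, coeff_monomial]
    have h2 : Finsupp.equivFunOnFinite.symm (Sum.elim u u) =
        Finsupp.equivFunOnFinite.symm (Sum.elim m n) ↔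
        u = Finsupp.equivFunOnFinite.symm m ∧ m = n := by
      rw [Equiv.apply_eq_iff_eq, Sum.elim_eq_iff, Equiv.eq_symm_apply]
      constructor
      · rintro ⟨h, h'⟩
        exact ⟨h, h.symm.trans h'⟩
      · rintro ⟨h, h'⟩
        exact ⟨h, h.trans h'⟩
    simp only [h2]
    split_ifs <;> simp_all

theorem hermitianPairing_diagonal (u v : ℂ) :
    hermitianPairing (Matrix.diagonal ![u, v]) =
      MvPolynomial.C u * (MvPolynomial.X (Sum.inl 0) * MvPolynomial.X (Sum.inr 0)) +
      MvPolynomial.C v * (MvPolynomial.X (Sum.inl 1) * MvPolynomial.X (Sum.inr 1)) := by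
  simp [hermitianPairing, Fin.sum_univ_two, mul_assoc]

theorem coe_cyclicGenerator_pow (ω : Circle) (a b j : ℕ) :
    ((cyclicGenerator ω a b ^ j : Matrix.unitaryGroup (Fin 2) ℂ) : Matrix (Fin 2) (Fin 2) ℂ) =
      Matrix.diagonal ![(ω : ℂ) ^ (j * a), (ω : ℂ) ^ (j * b)] := by
  rw [SubmonoidClass.coe_pow]
  change (Matrix.diagonal ![(ω : ℂ) ^ a, (ω : ℂ) ^ b]) ^ j = _
  rw [Matrix.diagonal_pow]
  congr 1
  ext i
  fin_cases i <;> simp [← pow_mul, mul_comm]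

theorem orderOf_cyclicGenerator {ω : Circle} {p a b : ℕ} (hω : IsPrimitiveRoot (ω : ℂ) p)
    (hcop : Nat.Coprime a b) : orderOf (cyclicGenerator ω a b) = p := by
  have h : ∀ j, cyclicGenerator ω a b ^ j = 1 ↔ p ∣ j := by
    intro j
    rw [← Subtype.coe_inj, coe_cyclicGenerator_pow]
    change _ = (1 : Matrix (Fin 2) (Fin 2) ℂ) ↔ _
    rw [← Matrix.diagonal_one, Matrix.diagonal_eq_diagonal_iff, Fin.forall_fin_two]
    simp only [Matrix.cons_val_zero, Matrix.cons_val_one, hω.pow_eq_one_iff_dvd]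
    rw [← Nat.dvd_gcd_iff, Nat.gcd_mul_left, Nat.Coprime.gcd_eq_one hcop, mul_one]
  exact Nat.dvd_antisymm (orderOf_dvd_of_pow_eq_one ((h p).2 dvd_rfl))
    ((h _).1 (pow_orderOf_eq_one _))

theorem natCard_cyclicGroup {ω : Circle} {p a b : ℕ} (hω : IsPrimitiveRoot (ω : ℂ) p)
    (hcop : Nat.Coprime a b) : Nat.card (cyclicGroup ω a b) = p := by
  rw [cyclicGroup, Nat.card_zpowers, orderOf_cyclicGenerator hω hcop]

theorem invariantPoly_cyclicGroup {ω : Circle} {p a b : ℕ} [NeZero p]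
    (hω : IsPrimitiveRoot (ω : ℂ) p) (hcop : Nat.Coprime a b) :
    invariantPoly (cyclicGroup ω a b) =
      MvPolynomial.bind₁ (fun i => MvPolynomial.X (Sum.inl i) * MvPolynomial.X (Sum.inr i))
        (1 - ∏ j ∈ Finset.range p, (1 - MvPolynomial.C ((ω : ℂ) ^ (j * a)) * MvPolynomial.X 0 -
          MvPolynomial.C ((ω : ℂ) ^ (j * b)) * MvPolynomial.X 1)) := by
  have horder := orderOf_cyclicGenerator hω hcop
  have hfin : IsOfFinOrder (cyclicGenerator ω a b) := by
    rw [← orderOf_pos_iff, horder]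
    exact NeZero.pos p
  rw [invariantPoly, map_sub, map_one, map_prod]
  congr 1
  change ∏ᶠ γ : Subgroup.zpowers (cyclicGenerator ω a b), _ = _
  rw [← finprod_comp_equiv (finEquivZPowers hfin), finprod_eq_prod_of_fintype, ← horder,
    ← Fin.prod_univ_eq_prod_range (fun j => MvPolynomial.bind₁ _ _)]
  refine Finset.prod_congr rfl fun j _ => ?_
  rw [finEquivZPowers_apply, coe_cyclicGenerator_pow, hermitianPairing_diagonal]
  simp only [map_sub, map_one, map_mul, MvPolynomial.bind₁_C_right, MvPolynomial.bind₁_X_right]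
  ring

theorem coeffMatrix_cyclicGroup {ω : Circle} {p a b : ℕ} [NeZero p]
    (hω : IsPrimitiveRoot (ω : ℂ) p) (hcop : Nat.Coprime a b) :
    coeffMatrix (cyclicGroup ω a b) = Matrix.diagonal fun α =>
      (1 - ∏ j ∈ Finset.range p, (1 - MvPolynomial.C ((ω : ℂ) ^ (j * a)) * MvPolynomial.X 0 -
          MvPolynomial.C ((ω : ℂ) ^ (j * b)) * MvPolynomial.X 1) : MvPolynomial (Fin 2) ℂ).coeff
        (Finsupp.equivFunOnFinite.symm fun i => (α i : ℕ)) := by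
  classical
  ext α β
  rw [coeffMatrix, invariantPoly_cyclicGroup hω hcop, MvPolynomial.coeff_bind₁_X_mul_X,
    Matrix.diagonal_apply]
  refine if_congr ?_ rfl rfl
  simp [funext_iff, Fin.ext_iff]

/-- Subtracting the product from 1 reverses the signs and kills the constant term, which is why α =
0 is excluded. -/
theorem coeff_invariantPoly_sign {ω : ℂ} {p a b : ℕ} [NeZero p] (hω : IsPrimitiveRoot ω p)
    (hab : a ≤ b) (hcop : Nat.Coprime a b) (α : Fin 2 →₀ ℕ) :
    (0 < (1 - ∏ j ∈ Finset.range p, (1 - MvPolynomial.C (ω ^ (j * a)) * MvPolynomial.X 0 -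
          MvPolynomial.C (ω ^ (j * b)) * MvPolynomial.X 1) : MvPolynomial (Fin 2) ℂ).coeff α ↔
      α ≠ 0 ∧ (α 0 + α 1 ≤ p ∧ p ∣ α 0 * a + α 1 * b) ∧
        ¬ (Even (α 0) ∧ Even (α 1) ∧ p ∣ α 0 / 2 * a + α 1 / 2 * b)) ∧
    ((1 - ∏ j ∈ Finset.range p, (1 - MvPolynomial.C (ω ^ (j * a)) * MvPolynomial.X 0 -
          MvPolynomial.C (ω ^ (j * b)) * MvPolynomial.X 1) : MvPolynomial (Fin 2) ℂ).coeff α < 0 ↔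
      α ≠ 0 ∧ (α 0 + α 1 ≤ p ∧ p ∣ α 0 * a + α 1 * b) ∧
        (Even (α 0) ∧ Even (α 1) ∧ p ∣ α 0 / 2 * a + α 1 / 2 * b)) := by
  by_cases hα : α = 0
  · have : (1 - ∏ j ∈ Finset.range p, (1 - MvPolynomial.C (ω ^ (j * a)) * MvPolynomial.X 0 -
          MvPolynomial.C (ω ^ (j * b)) * MvPolynomial.X 1) : MvPolynomial (Fin 2) ℂ).coeff α = 0 := by
      rw [hα, ← MvPolynomial.constantCoeff_eq]
      simp
    rw [this]
    simp [hα]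
  · obtain ⟨N, hN, hcoeff⟩ := MvPolynomial.coeff_prod_one_sub hω hab hcop α
    rw [MvPolynomial.coeff_sub, hcoeff, MvPolynomial.coeff_one, if_neg (Ne.symm hα), zero_sub,
      ← hN]
    have hneg : ¬ (N : ℂ) < 0 := not_lt_of_ge (Nat.cast_nonneg N)
    by_cases h : Even (α 0) ∧ Even (α 1) ∧ p ∣ α 0 / 2 * a + α 1 / 2 * b
    · simp [h, hα, hneg]
    · simp only [h, if_false]
      simp [hα, hneg]

/-! ### Reduction to lattice points in triangles. -/

/-- The number of lattice points `(r, s)` with `p ∣ r a + s b` in the triangle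
`d (r + s) ≤ p`. -/
def latticeCount (a b d p : ℕ) : ℕ :=
  Finset.card {x ∈ Finset.range (p + 1) ×ˢ Finset.range (p + 1) |
    d * (x.1 + x.2) ≤ p ∧ p ∣ x.1 * a + x.2 * b}

theorem card_filter_fin_two_arrow (n : ℕ) (Q : ℕ → ℕ → Prop) [DecidableRel Q] :
    Finset.card {α : Fin 2 → Fin (n + 1) | Q (α 0) (α 1)} =
      Finset.card {x ∈ Finset.range (n + 1) ×ˢ Finset.range (n + 1) | Q x.1 x.2} := by
  refine Finset.card_bij (fun α _ => ((α 0 : ℕ), (α 1 : ℕ))) ?_ ?_ ?_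
  · intro α hα
    simp only [Finset.mem_filter, Finset.mem_univ, true_and] at hα
    simp only [Finset.mem_filter, Finset.mem_product, Finset.mem_range]
    exact ⟨⟨(α 0).2, (α 1).2⟩, hα⟩
  · intro α _ β _ h
    simp only [Prod.mk.injEq, Fin.val_inj] at h
    ext i
    fin_cases i <;> simp [h]
  · rintro ⟨x, y⟩ h
    simp only [Finset.mem_filter, Finset.mem_product, Finset.mem_range] at h
    exact ⟨![⟨x, h.1.1⟩, ⟨y, h.1.2⟩], by simp [h.2], by simp⟩

theorem latticeCount_eq_card_ne_zero_add_one (a b d p : ℕ) :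
    latticeCount a b d p = Finset.card {x ∈ Finset.range (p + 1) ×ˢ Finset.range (p + 1) |
      ¬ (x.1 = 0 ∧ x.2 = 0) ∧ d * (x.1 + x.2) ≤ p ∧ p ∣ x.1 * a + x.2 * b} + 1 := by
  rw [latticeCount, ← Finset.card_erase_add_one (a := (0, 0)) (by simp)]
  congr 2
  ext ⟨x, y⟩
  simp only [Finset.mem_erase, Finset.mem_filter, ne_eq, Prod.mk.injEq]
  tauto

/-- Doubling matches the lattice points of 2(r + s) ≤ p with the exponents of negative coefficients.
The summand 1 is the origin, a lattice point whose coefficient is zero. -/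
theorem numPos_numNeg_cyclicGroup {ω : Circle} {p a b : ℕ} [NeZero p]
    (hω : IsPrimitiveRoot (ω : ℂ) p) (hab : a ≤ b) (hcop : Nat.Coprime a b) :
    latticeCount a b 2 p = numNeg (cyclicGroup ω a b) + 1 ∧
    latticeCount a b 1 p = numPos (cyclicGroup ω a b) + numNeg (cyclicGroup ω a b) + 1 := by
  classical
  have hzero : ∀ α : Fin 2 → Fin (Nat.card (cyclicGroup ω a b) + 1),
      Finsupp.equivFunOnFinite.symm (fun i => (α i : ℕ)) ≠ 0 ↔
        ¬ ((α 0 : ℕ) = 0 ∧ (α 1 : ℕ) = 0) := by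
    intro α
    rw [Ne, Finsupp.ext_iff, Fin.forall_fin_two]
    simp
  have hpos : numPos (cyclicGroup ω a b) =
      Finset.card {x ∈ Finset.range (p + 1) ×ˢ Finset.range (p + 1) |
        ¬ (x.1 = 0 ∧ x.2 = 0) ∧ (x.1 + x.2 ≤ p ∧ p ∣ x.1 * a + x.2 * b) ∧
        ¬ (Even x.1 ∧ Even x.2 ∧ p ∣ x.1 / 2 * a + x.2 / 2 * b)} := by
    rw [numPos, coeffMatrix_cyclicGroup hω hcop, Matrix.countP_roots_charpoly_diagonal]
    simp only [(coeff_invariantPoly_sign hω hab hcop _).1, hzero,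
      Finsupp.equivFunOnFinite_symm_apply_apply]
    rw [card_filter_fin_two_arrow _ fun x y => ¬ (x = 0 ∧ y = 0) ∧ (x + y ≤ p ∧ p ∣ x * a + y * b) ∧
        ¬ (Even x ∧ Even y ∧ p ∣ x / 2 * a + y / 2 * b), natCard_cyclicGroup hω hcop]
  have hneg : numNeg (cyclicGroup ω a b) =
      Finset.card {x ∈ Finset.range (p + 1) ×ˢ Finset.range (p + 1) |
        ¬ (x.1 = 0 ∧ x.2 = 0) ∧ (x.1 + x.2 ≤ p ∧ p ∣ x.1 * a + x.2 * b) ∧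
        (Even x.1 ∧ Even x.2 ∧ p ∣ x.1 / 2 * a + x.2 / 2 * b)} := by
    rw [numNeg, coeffMatrix_cyclicGroup hω hcop, Matrix.countP_roots_charpoly_diagonal]
    simp only [(coeff_invariantPoly_sign hω hab hcop _).2, hzero,
      Finsupp.equivFunOnFinite_symm_apply_apply]
    rw [card_filter_fin_two_arrow _ fun x y => ¬ (x = 0 ∧ y = 0) ∧ (x + y ≤ p ∧ p ∣ x * a + y * b) ∧
        (Even x ∧ Even y ∧ p ∣ x / 2 * a + y / 2 * b), natCard_cyclicGroup hω hcop]
  rw [latticeCount_eq_card_ne_zero_add_one, latticeCount_eq_card_ne_zero_add_one, hpos, hneg]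
  refine ⟨?_, ?_⟩
  · congr 1
    refine Finset.card_bij' (fun x _ => (2 * x.1, 2 * x.2)) (fun x _ => (x.1 / 2, x.2 / 2))
      ?_ ?_ ?_ ?_
    · rintro ⟨x, y⟩ h
      simp only [Finset.mem_filter, Finset.mem_product, Finset.mem_range] at h ⊢
      obtain ⟨-, h1, h2, h3⟩ := h
      have h4 : p ∣ 2 * x * a + 2 * y * b := by
        have := h3.mul_left 2
        rwa [mul_add, ← mul_assoc, ← mul_assoc] at this
      refine ⟨by omega, by omega, ⟨by omega, h4⟩, even_two_mul _, even_two_mul _, ?_⟩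
      rwa [Nat.mul_div_cancel_left _ two_pos, Nat.mul_div_cancel_left _ two_pos]
    · rintro ⟨x, y⟩ h
      simp only [Finset.mem_filter, Finset.mem_product, Finset.mem_range] at h ⊢
      obtain ⟨-, h1, ⟨h2, -⟩, ⟨x, rfl⟩, ⟨y, rfl⟩, h3⟩ := h
      exact ⟨by omega, by omega, by omega, h3⟩
    · simp
    · rintro ⟨x, y⟩ h
      simp only [Finset.mem_filter] at h
      obtain ⟨-, -, -, hx, hy, -⟩ := h
      simp [Nat.two_mul_div_two_of_even hx, Nat.two_mul_div_two_of_even hy]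
  · congr 1
    rw [add_comm (Finset.card _), ← Finset.card_union_of_disjoint]
    · congr 1
      ext x
      simp only [Finset.mem_filter, Finset.mem_union, one_mul]
      tauto
    · rw [Finset.disjoint_left]
      intro x
      simp only [Finset.mem_filter]
      tauto

theorem positivityRatio_cyclicGroup {ω : Circle} {p a b : ℕ} [NeZero p]
    (hω : IsPrimitiveRoot (ω : ℂ) p) (hab : a ≤ b) (hcop : Nat.Coprime a b) :
    positivityRatio (cyclicGroup ω a b) =
      ((latticeCount a b 1 p : ℝ) - latticeCount a b 2 p) / ((latticeCount a b 1 p : ℝ) - 1) := by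
  obtain ⟨h1, h2⟩ := numPos_numNeg_cyclicGroup hω hab hcop
  rw [positivityRatio, h1, h2]
  push_cast
  congr 1 <;> ring

/-! ### Asymptotics of the lattice point counts. -/

/-- Slice by ra + sb = kp; k ≤ b because r + s ≤ p. Eliminating s leaves a congruence mod b, the
condition s ≥ 0, and d(r + s) ≤ p multiplied by b. -/
theorem latticeCount_eq_sum {a b d p : ℕ} (hp : 0 < p) (hd : 0 < d) (hb : 0 < b) (hab : a ≤ b) :
    latticeCount a b d p = ∑ k ∈ Finset.range (b + 1),
      Finset.card {x ∈ Finset.range (p + 1) |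
        x * a ≡ k * p [MOD b] ∧ x * a ≤ k * p ∧ d * (x * (b - a) + k * p) ≤ p * b} := by
  obtain ⟨c, rfl⟩ := Nat.exists_eq_add_of_le hab
  rw [latticeCount, Finset.card_eq_sum_card_fiberwise (f := fun x => (x.1 * a + x.2 * (a + c)) / p)
    (t := Finset.range (a + c + 1))]
  · refine Finset.sum_congr rfl fun k _ => ?_
    have hmem : ∀ x y : ℕ, p ∣ x * a + y * (a + c) →
        (x * a + y * (a + c)) / p = k → x * a + y * (a + c) = k * p := by
      intro x y h1 h2
      rw [← h2, Nat.div_mul_cancel h1]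
    refine Finset.card_bij (fun x _ => x.1) ?_ ?_ ?_
    · rintro ⟨x, y⟩ h
      simp only [Finset.mem_filter, Finset.mem_product, Finset.mem_range] at h ⊢
      obtain ⟨⟨⟨h1, h2⟩, h3, h4⟩, h5⟩ := h
      have h6 := hmem x y h4 h5
      refine ⟨h1, ?_, by omega, ?_⟩
      · rw [← h6]
        simp [Nat.ModEq]
      · have : x * (a + c - a) + k * p = (x + y) * (a + c) := by
          rw [← h6, Nat.add_sub_cancel_left]
          ring
        rw [this, ← mul_assoc]
        exact Nat.mul_le_mul_right _ h3
    · rintro ⟨x, y⟩ h ⟨x', y'⟩ h' hxx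
      simp only [Finset.mem_filter, Finset.mem_product, Finset.mem_range] at h h' hxx
      subst hxx
      have h6 := hmem x y h.1.2.2 h.2
      have h7 := hmem x y' h'.1.2.2 h'.2
      have : y * (a + c) = y' * (a + c) := by omega
      rw [Nat.eq_of_mul_eq_mul_right hb this]
    · intro x h
      simp only [Finset.mem_filter, Finset.mem_range] at h
      obtain ⟨h1, h2, h3, h4⟩ := h
      obtain ⟨y, hy⟩ := (Nat.modEq_iff_dvd' h3).1 h2
      have h5 : x * a + y * (a + c) = k * p := by
        rw [mul_comm y, ← hy]
        omega
      have h6 : d * (x + y) ≤ p := by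
        refine Nat.le_of_mul_le_mul_right ?_ hb
        refine le_trans (le_of_eq ?_) h4
        rw [← h5, Nat.add_sub_cancel_left]
        ring
      have h7 : x + y ≤ p := le_trans (Nat.le_mul_of_pos_left _ hd) h6
      refine ⟨(x, y), ?_, rfl⟩
      simp only [Finset.mem_filter, Finset.mem_product, Finset.mem_range, h5]
      exact ⟨⟨⟨by omega, by omega⟩, h6, dvd_mul_left _ _⟩, Nat.mul_div_cancel _ hp⟩
  · rintro ⟨x, y⟩ h
    simp only [Finset.coe_filter, Finset.mem_product, Finset.mem_range, Set.mem_ofPred_eq,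
      Finset.coe_range, Set.mem_Iio] at h ⊢
    have h7 : x + y ≤ p := le_trans (Nat.le_mul_of_pos_left _ hd) h.2.1
    rw [Nat.lt_succ_iff]
    refine Nat.div_le_of_le_mul ?_
    calc x * a + y * (a + c) ≤ (x + y) * (a + c) := by nlinarith [Nat.zero_le (x * c)]
      _ ≤ p * (a + c) := Nat.mul_le_mul_right _ h7

theorem abs_card_modEq_le_sub_le {b : ℕ} (hb : 0 < b) (v : ℕ) (y : ℝ) (hy : 0 ≤ y) (T : Finset ℕ)
    (hT : ∀ x, x ∈ T ↔ x ≡ v [MOD b] ∧ (x : ℝ) ≤ y) :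
    |(T.card : ℝ) - y / b| ≤ 2 := by
  have h1 : T.card = (⌊y⌋₊ + 1).count (· ≡ v [MOD b]) := by
    rw [Nat.count_eq_card_filter_range]
    congr 1
    ext x
    rw [hT, Finset.mem_filter, Finset.mem_range, Nat.lt_succ_iff, Nat.le_floor_iff hy, and_comm]
  rw [Nat.count_modEq_card _ hb] at h1
  have h2 : (⌊y⌋₊ + 1) / b ≤ T.card ∧ T.card ≤ (⌊y⌋₊ + 1) / b + 1 := by
    rw [h1]
    split_ifs <;> omega
  have h3 := Nat.div_add_mod (⌊y⌋₊ + 1) b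
  have h4 := Nat.mod_lt (⌊y⌋₊ + 1) hb
  have hb' : (1 : ℝ) ≤ b := by exact_mod_cast hb
  have h5 : (⌊y⌋₊ : ℝ) ≤ y := Nat.floor_le hy
  have h6 : y < ⌊y⌋₊ + 1 := Nat.lt_floor_add_one y
  set q := (⌊y⌋₊ + 1) / b
  have h7 : (b : ℝ) * q ≤ ⌊y⌋₊ + 1 := by exact_mod_cast (by omega : b * q ≤ ⌊y⌋₊ + 1)
  have h8 : (⌊y⌋₊ + 1 : ℝ) ≤ b * q + b := by exact_mod_cast (by omega : ⌊y⌋₊ + 1 ≤ b * q + b)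
  have h9 : (q : ℝ) ≤ T.card := by exact_mod_cast h2.1
  have h10 : (T.card : ℝ) ≤ q + 1 := by exact_mod_cast h2.2
  have h11 : y / b ≤ q + 1 := by
    rw [div_le_iff₀ (by linarith)]
    linarith
  have h12 : (q : ℝ) - 1 ≤ y / b := by
    rw [le_div_iff₀ (by linarith)]
    linarith
  rw [abs_le]
  constructor <;> linarith

/-- The limiting length, in the coordinate `r` and relative to `p`, of the part of the line
`r a + s b = k p` in the triangle `d (r + s) ≤ p`. -/
noncomputable def lineLength (a b d k : ℕ) : ℝ :=
  if d * k ≤ a ∧ 0 < a then (k : ℝ) / a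
  else if d * k ≤ b then ((b : ℝ) - d * k) / (d * ((b : ℝ) - a)) else 0

theorem tendsto_card_line {a b d k : ℕ} (hd : 0 < d) (hab : a ≤ b) (hcop : Nat.Coprime a b)
    (hb : 0 < b) :
    Tendsto (fun p : ℕ => (Finset.card {x ∈ Finset.range (p + 1) |
        x * a ≡ k * p [MOD b] ∧ x * a ≤ k * p ∧ d * (x * (b - a) + k * p) ≤ p * b} : ℝ) / p)
      atTop (𝓝 (lineLength a b d k / b)) := by
  obtain ⟨c, rfl⟩ := Nat.exists_eq_add_of_le hab
  rw [Nat.add_sub_cancel_left]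
  by_cases hk : d * k ≤ a + c
  -- The two upper bounds on x are x ≤ kp/a and x ≤ (b - dk)p/(d(b - a)); the first is the tighter
  -- one exactly when dk ≤ a. Only one is needed, and it also implies x ≤ p.
  · suffices H : 0 ≤ lineLength a (a + c) d k ∧ ∀ p x : ℕ, 0 < p →
        ((x * a ≤ k * p ∧ d * (x * c + k * p) ≤ p * (a + c)) ↔
          (x : ℝ) ≤ lineLength a (a + c) d k * p) ∧
        (x * a ≤ k * p → d * (x * c + k * p) ≤ p * (a + c) → x ≤ p) by
      obtain ⟨h0, H⟩ := H
      rw [tendsto_iff_norm_sub_tendsto_zero]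
      refine squeeze_zero' (Eventually.of_forall fun _ => norm_nonneg _)
        (g := fun p : ℕ => 2 / (p : ℝ)) ?_ (tendsto_const_div_atTop_nhds_zero_nat 2)
      filter_upwards [eventually_gt_atTop 0] with p hp
      have hp' : (0 : ℝ) < p := by exact_mod_cast hp
      -- As a is invertible modulo b, the congruence selects one residue class, of density 1/b.
      obtain ⟨v, hv⟩ : ∃ v, ∀ x, x * a ≡ k * p [MOD (a + c)] ↔ x ≡ v [MOD (a + c)] := by
        obtain ⟨w, -, hw⟩ := Nat.exists_mul_mod_eq_of_coprime (k * p) hcop hb.ne'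
        refine ⟨w, fun x => ?_⟩
        have hw' : w * a ≡ k * p [MOD (a + c)] := by
          rw [mul_comm]
          exact hw
        constructor
        · intro h
          exact Nat.ModEq.cancel_right_of_coprime hcop.symm (h.trans hw'.symm)
        · intro h
          exact (h.mul_right a).trans hw'
      have h1 := abs_card_modEq_le_sub_le hb v (lineLength a (a + c) d k * p)
        (mul_nonneg h0 hp'.le) ({x ∈ Finset.range (p + 1) |
        x * a ≡ k * p [MOD (a + c)] ∧ x * a ≤ k * p ∧ d * (x * c + k * p) ≤ p * (a + c)}) (by
          intro x
          rw [Finset.mem_filter, Finset.mem_range, Nat.lt_succ_iff, hv, (H p x hp).1]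
          refine ⟨fun h => h.2, fun h => ⟨?_, h⟩⟩
          have h2 := (H p x hp).1.2 h.2
          exact (H p x hp).2 h2.1 h2.2)
      rw [Real.norm_eq_abs, le_div_iff₀ hp', ← abs_of_pos hp', ← abs_mul, abs_of_pos hp']
      refine le_trans (le_of_eq ?_) h1
      congr 1
      field_simp
    have hd' : (0 : ℝ) < d := by exact_mod_cast hd
    rw [lineLength]
    split_ifs with h
    · obtain ⟨h1, h2⟩ := h
      have h2' : (0 : ℝ) < a := by exact_mod_cast h2
      refine ⟨by positivity, fun p x hp => ?_⟩
      have hiff : (x : ℝ) ≤ (k : ℝ) / a * p ↔ x * a ≤ k * p := by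
        rw [div_mul_eq_mul_div, le_div_iff₀ h2']
        exact_mod_cast Iff.rfl
      have hka : k ≤ a := le_trans (Nat.le_mul_of_pos_left _ hd) h1
      rw [hiff]
      refine ⟨⟨fun h => h.1, fun h => ⟨h, ?_⟩⟩, fun h _ => ?_⟩
      · refine Nat.le_of_mul_le_mul_left ?_ h2
        calc a * (d * (x * c + k * p)) = d * (x * a * c + k * p * a) := by ring
          _ ≤ d * (k * p * c + k * p * a) := by gcongr
          _ = d * k * (p * (a + c)) := by ring
          _ ≤ a * (p * (a + c)) := by gcongr
      · refine Nat.le_of_mul_le_mul_right (h.trans ?_) h2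
        rw [mul_comm p]
        gcongr
    · have hac : a ≤ d * k := by
        by_contra h'
        exact h ⟨by omega, by omega⟩
      have hc : 0 < c := by
        rcases Nat.eq_zero_or_pos c with rfl | h'
        · exact absurd ⟨hk, hb⟩ h
        · exact h'
      have hc' : (0 : ℝ) < c := by exact_mod_cast hc
      have hk' : (d : ℝ) * k ≤ a + c := by exact_mod_cast hk
      push_cast
      rw [add_sub_cancel_left]
      refine ⟨div_nonneg (by linarith) (by positivity), fun p x hp => ?_⟩
      have hiff : (x : ℝ) ≤ ((a : ℝ) + c - d * k) / (d * c) * p ↔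
          d * (x * c + k * p) ≤ p * (a + c) := by
        rw [div_mul_eq_mul_div, le_div_iff₀ (by positivity), ← Nat.cast_le (α := ℝ)]
        push_cast
        constructor <;> intro h <;> nlinarith
      rw [hiff]
      refine ⟨⟨fun h => h.2, fun h => ⟨?_, h⟩⟩, fun _ h => ?_⟩
      · zify at h hac hk hc hd ⊢
        have h1 : (d * c : ℤ) * (x * a) ≤ d * c * (k * p) := by
          have hp0 : (0 : ℤ) ≤ p := by positivity
          have ha0 : (0 : ℤ) ≤ a := by positivity
          nlinarith [mul_le_mul_of_nonneg_left h ha0,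
            mul_le_mul_of_nonneg_left hac (mul_nonneg hp0 (by positivity : (0 : ℤ) ≤ a + c))]
        exact le_of_mul_le_mul_left h1 (by positivity)
      · have h1 : d * c * x ≤ d * c * p := by
          have h2 : a * p ≤ d * k * p := Nat.mul_le_mul_right _ hac
          have h3 : c * p ≤ d * c * p :=
            Nat.mul_le_mul_right _ (Nat.le_mul_of_pos_left _ hd)
          nlinarith
        exact Nat.le_of_mul_le_mul_left h1 (by positivity)
  · have h0 : lineLength a (a + c) d k = 0 := by
      rw [lineLength, if_neg (by omega), if_neg hk]
    rw [h0, zero_div]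
    refine tendsto_const_nhds.congr' ?_
    filter_upwards [eventually_gt_atTop 0] with p hp
    rw [Finset.filter_false_of_mem, Finset.card_empty, Nat.cast_zero, zero_div]
    rintro x - ⟨-, -, h⟩
    apply hk
    refine Nat.le_of_mul_le_mul_right (le_trans ?_ (h.trans (mul_comm _ _).le)) hp
    rw [mul_assoc]
    exact Nat.mul_le_mul_left _ (Nat.le_add_left _ _)

theorem tendsto_latticeCount {a b d : ℕ} (hd : 0 < d) (hab : a ≤ b) (hcop : Nat.Coprime a b)
    (hb : 0 < b) :
    Tendsto (fun p : ℕ => (latticeCount a b d p : ℝ) / p) atTop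
      (𝓝 (∑ k ∈ Finset.range (b + 1), lineLength a b d k / b)) := by
  refine (tendsto_finsetSum (Finset.range (b + 1)) fun k _ =>
    tendsto_card_line (k := k) hd hab hcop hb).congr' ?_
  filter_upwards [eventually_gt_atTop 0] with p hp
  rw [latticeCount_eq_sum hp hd hb hab, Nat.cast_sum, Finset.sum_div]

/-- The lines with k ≤ a/d end on the edge s = 0, those with a/d < k ≤ b/d on the hypotenuse, and
the later ones miss the triangle. -/
theorem sum_lineLength {a b d : ℕ} (hd : 0 < d) (ha : 0 < a) (hab : a < b) :
    ∑ k ∈ Finset.range (b + 1), lineLength a b d k =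
      ((a / d : ℕ) : ℝ) * ((a / d : ℕ) + 1) / (2 * a) +
      ((((b / d : ℕ) : ℝ) - (a / d : ℕ)) * b -
        d * (((b / d : ℕ) : ℝ) * ((b / d : ℕ) + 1) - ((a / d : ℕ) : ℝ) * ((a / d : ℕ) + 1)) / 2) /
        (d * ((b : ℝ) - a)) := by
  have hmono : a / d ≤ b / d := Nat.div_le_div_right hab.le
  have hbd : b / d ≤ b := Nat.div_le_self b d
  have hsum : ∀ n : ℕ, ∑ k ∈ Finset.range (n + 1), (k : ℝ) = (n : ℝ) * (n + 1) / 2 := by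
    intro n
    induction n with
    | zero => simp
    | succ n ih =>
      rw [Finset.sum_range_succ, ih]
      push_cast
      ring
  have hsum2 : ∀ n : ℕ, ∑ k ∈ Finset.range (n + 1), ((b : ℝ) - d * k) =
      (n + 1) * b - d * ((n : ℝ) * (n + 1) / 2) := by
    intro n
    rw [Finset.sum_sub_distrib, ← Finset.mul_sum, hsum]
    simp
  rw [← Finset.sum_range_add_sum_Ico _ (by omega : b / d + 1 ≤ b + 1),
    ← Finset.sum_range_add_sum_Ico _ (by omega : a / d + 1 ≤ b / d + 1)]
  have h1 : ∑ k ∈ Finset.range (a / d + 1), lineLength a b d k =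
      ∑ k ∈ Finset.range (a / d + 1), (k : ℝ) / a := by
    refine Finset.sum_congr rfl fun k hk => ?_
    rw [Finset.mem_range, Nat.lt_succ_iff, Nat.le_div_iff_mul_le hd, mul_comm] at hk
    rw [lineLength, if_pos ⟨hk, ha⟩]
  have h2 : ∑ k ∈ Finset.Ico (a / d + 1) (b / d + 1), lineLength a b d k =
      ∑ k ∈ Finset.Ico (a / d + 1) (b / d + 1), ((b : ℝ) - d * k) / (d * ((b : ℝ) - a)) := by
    refine Finset.sum_congr rfl fun k hk => ?_
    rw [Finset.mem_Ico, Nat.lt_succ_iff, Nat.succ_le_iff, Nat.div_lt_iff_lt_mul hd,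
      Nat.le_div_iff_mul_le hd, mul_comm] at hk
    rw [lineLength, if_neg (by omega), if_pos hk.2]
  have h3 : ∑ k ∈ Finset.Ico (b / d + 1) (b + 1), lineLength a b d k = 0 := by
    refine Finset.sum_eq_zero fun k hk => ?_
    rw [Finset.mem_Ico, Nat.succ_le_iff, Nat.div_lt_iff_lt_mul hd, mul_comm] at hk
    rw [lineLength, if_neg (by omega), if_neg (by omega)]
  rw [h1, h2, h3, ← Finset.sum_div, ← Finset.sum_div, hsum, Finset.sum_Ico_eq_sub _ (by omega),
    hsum2, hsum2, add_zero]
  congr 1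
  · rw [div_div]
  · congr 1
    ring

/-! ### The limits of the positivity ratio. -/

theorem tendsto_positivityRatio (ω : ℕ → Circle) (hω : ∀ p : ℕ, 0 < p → IsPrimitiveRoot (ω p) p)
    {a b : ℕ} (hab : a ≤ b) (hcop : Nat.Coprime a b) (hb : 0 < b)
    (hne : ∑ k ∈ Finset.range (b + 1), lineLength a b 1 k ≠ 0) :
    Tendsto (fun p : ℕ => positivityRatio (cyclicGroup (ω p) a b)) atTop
      (𝓝 (1 - (∑ k ∈ Finset.range (b + 1), lineLength a b 2 k) /
        ∑ k ∈ Finset.range (b + 1), lineLength a b 1 k)) := by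
  have h1 := tendsto_latticeCount one_pos hab hcop hb
  have h2 := tendsto_latticeCount two_pos hab hcop hb
  rw [← Finset.sum_div] at h1 h2
  set s₁ := ∑ k ∈ Finset.range (b + 1), lineLength a b 1 k
  set s₂ := ∑ k ∈ Finset.range (b + 1), lineLength a b 2 k
  have hb' : (b : ℝ) ≠ 0 := by exact_mod_cast hb.ne'
  have h3 := (h1.sub h2).div (h1.sub (tendsto_const_div_atTop_nhds_zero_nat (1 : ℝ)))
    (by rw [sub_zero]; exact div_ne_zero hne hb')
  have h4 : (s₁ / b - s₂ / b) / (s₁ / b - 0) = 1 - s₂ / s₁ := by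
    rw [sub_zero, ← sub_div, div_div_div_cancel_right₀ hb', sub_div, div_self hne]
  rw [h4] at h3
  refine h3.congr' ?_
  filter_upwards [eventually_gt_atTop 0] with p hp
  have : NeZero p := ⟨hp.ne'⟩
  have hp' : (p : ℝ) ≠ 0 := by exact_mod_cast hp.ne'
  have hωp : IsPrimitiveRoot (ω p : ℂ) p :=
    (hω p hp).map_of_injective (f := Circle.coeHom) Circle.coe_injective
  rw [positivityRatio_cyclicGroup hωp hab hcop]
  simp only [Pi.div_apply]
  rw [← sub_div, ← sub_div, div_div_div_cancel_right₀ hp']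

theorem sum_lineLength_one {a b : ℕ} (ha : 0 < a) (hab : a < b) :
    ∑ k ∈ Finset.range (b + 1), lineLength a b 1 k = b / 2 := by
  have ha' : (a : ℝ) ≠ 0 := by exact_mod_cast ha.ne'
  have hab' : (b : ℝ) - a ≠ 0 := sub_ne_zero.2 (by exact_mod_cast hab.ne')
  rw [sum_lineLength one_pos ha hab, Nat.div_one, Nat.div_one]
  push_cast
  field_simp
  ring

theorem tendsto_positivityRatio_of_lt (ω : ℕ → Circle)
    (hω : ∀ p : ℕ, 0 < p → IsPrimitiveRoot (ω p) p) {a b : ℕ} (ha : 0 < a) (hab : a < b)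
    (hcop : Nat.Coprime a b) {L : ℝ}
    (hL : 1 - (((a / 2 : ℕ) : ℝ) * ((a / 2 : ℕ) + 1) / (2 * a) +
      ((((b / 2 : ℕ) : ℝ) - (a / 2 : ℕ)) * b -
        (((b / 2 : ℕ) : ℝ) * ((b / 2 : ℕ) + 1) - ((a / 2 : ℕ) : ℝ) * ((a / 2 : ℕ) + 1))) /
        (2 * ((b : ℝ) - a))) / (b / 2) = L) :
    Tendsto (fun p : ℕ => positivityRatio (cyclicGroup (ω p) a b)) atTop (𝓝 L) := by
  have hb : 0 < b := ha.trans hab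
  have hb' : (b : ℝ) / 2 ≠ 0 := by positivity
  have h := tendsto_positivityRatio ω hω hab.le hcop hb (by rwa [sum_lineLength_one ha hab])
  rw [sum_lineLength_one ha hab, sum_lineLength two_pos ha hab] at h
  convert h using 2
  rw [← hL]
  push_cast
  ring

theorem tendsto_positivityRatio_odd_even (ω : ℕ → Circle)
    (hω : ∀ p : ℕ, 0 < p → IsPrimitiveRoot (ω p) p) {a b : ℕ} (hab : a ≤ b)
    (hcop : Nat.Coprime a b) (ha : Odd a) (hb : Even b) :
    Tendsto (fun p : ℕ => positivityRatio (cyclicGroup (ω p) a b)) atTop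
      (𝓝 ((3 * (a : ℝ) * ((b : ℝ) - (a : ℝ)) + 1) / (4 * (a : ℝ) * ((b : ℝ) - (a : ℝ))))) := by
  have hne : a ≠ b := by
    rintro rfl
    exact Nat.not_even_iff_odd.2 ha hb
  have hlt : a < b := lt_of_le_of_ne hab hne
  refine tendsto_positivityRatio_of_lt ω hω ha.pos hlt hcop ?_
  have ha' : (a : ℝ) ≠ 0 := by exact_mod_cast ha.pos.ne'
  have hb' : (b : ℝ) ≠ 0 := by exact_mod_cast (ha.pos.trans hlt).ne'
  have hc' : (b : ℝ) - a ≠ 0 := sub_ne_zero.2 (by exact_mod_cast hlt.ne')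
  have h1 : ((a / 2 : ℕ) : ℝ) = (a - 1) / 2 := by
    obtain ⟨m, rfl⟩ := ha
    rw [show (2 * m + 1) / 2 = m by omega]
    push_cast
    ring
  have h2 : ((b / 2 : ℕ) : ℝ) = b / 2 := by
    obtain ⟨m, rfl⟩ := hb
    rw [show (m + m) / 2 = m by omega]
    push_cast
    ring
  rw [h1, h2]
  field_simp
  ring

theorem tendsto_positivityRatio_odd_odd (ω : ℕ → Circle)
    (hω : ∀ p : ℕ, 0 < p → IsPrimitiveRoot (ω p) p) {a b : ℕ} (hab : a ≤ b)
    (hcop : Nat.Coprime a b) (ha : Odd a) (hb : Odd b) :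
    Tendsto (fun p : ℕ => positivityRatio (cyclicGroup (ω p) a b)) atTop
      (𝓝 ((3 * (a : ℝ) * (b : ℝ) + 1) / (4 * (a : ℝ) * (b : ℝ)))) := by
  rcases hab.eq_or_lt with rfl | hlt
  -- Degenerate case q₁ = q₂ = 1: the line k = 1 is the hypotenuse itself, so the general sum
  -- formula does not apply.
  · obtain rfl : a = 1 := by simpa using hcop
    have h1 : ∑ k ∈ Finset.range (1 + 1), lineLength 1 1 1 k = 1 := by
      simp [Finset.sum_range_succ, lineLength]
    have h2 : ∑ k ∈ Finset.range (1 + 1), lineLength 1 1 2 k = 0 := by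
      simp [Finset.sum_range_succ, lineLength]
    have h := tendsto_positivityRatio ω hω le_rfl hcop one_pos (by rw [h1]; exact one_ne_zero)
    rw [h1, h2] at h
    convert h using 2
    norm_num
  · refine tendsto_positivityRatio_of_lt ω hω ha.pos hlt hcop ?_
    have ha' : (a : ℝ) ≠ 0 := by exact_mod_cast ha.pos.ne'
    have hb' : (b : ℝ) ≠ 0 := by exact_mod_cast hb.pos.ne'
    have hc' : (b : ℝ) - a ≠ 0 := sub_ne_zero.2 (by exact_mod_cast hlt.ne')
    have h1 : ((a / 2 : ℕ) : ℝ) = (a - 1) / 2 := by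
      obtain ⟨m, rfl⟩ := ha
      rw [show (2 * m + 1) / 2 = m by omega]
      push_cast
      ring
    have h2 : ((b / 2 : ℕ) : ℝ) = (b - 1) / 2 := by
      obtain ⟨m, rfl⟩ := hb
      rw [show (2 * m + 1) / 2 = m by omega]
      push_cast
      ring
    rw [h1, h2]
    field_simp
    ring

theorem tendsto_positivityRatio_even_odd (ω : ℕ → Circle)
    (hω : ∀ p : ℕ, 0 < p → IsPrimitiveRoot (ω p) p) {a b : ℕ} (hab : a ≤ b)
    (hcop : Nat.Coprime a b) (ha : Even a) (hb : Odd b) :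
    Tendsto (fun p : ℕ => positivityRatio (cyclicGroup (ω p) a b)) atTop
      (𝓝 ((3 * (b : ℝ) * ((b : ℝ) - (a : ℝ)) - 1) / (4 * (b : ℝ) * ((b : ℝ) - (a : ℝ))))) := by
  rcases Nat.eq_zero_or_pos a with rfl | ha0
  -- Degenerate case (0, 1): the line k = 0 is the edge s = 0 itself.
  · obtain rfl : b = 1 := by simpa using hcop
    have h1 : ∑ k ∈ Finset.range (1 + 1), lineLength 0 1 1 k = 1 := by
      simp [Finset.sum_range_succ, lineLength]
    have h2 : ∑ k ∈ Finset.range (1 + 1), lineLength 0 1 2 k = 1 / 2 := by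
      simp [Finset.sum_range_succ, lineLength]
    have h := tendsto_positivityRatio ω hω hab hcop one_pos (by rw [h1]; exact one_ne_zero)
    rw [h1, h2] at h
    convert h using 2
    norm_num
  · have hne : a ≠ b := by
      rintro rfl
      exact Nat.not_even_iff_odd.2 hb ha
    have hlt : a < b := lt_of_le_of_ne hab hne
    refine tendsto_positivityRatio_of_lt ω hω ha0 hlt hcop ?_
    have ha' : (a : ℝ) ≠ 0 := by exact_mod_cast ha0.ne'
    have hb' : (b : ℝ) ≠ 0 := by exact_mod_cast hb.pos.ne'
    have hc' : (b : ℝ) - a ≠ 0 := sub_ne_zero.2 (by exact_mod_cast hlt.ne')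
    have h1 : ((a / 2 : ℕ) : ℝ) = a / 2 := by
      obtain ⟨m, rfl⟩ := ha
      rw [show (m + m) / 2 = m by omega]
      push_cast
      ring
    have h2 : ((b / 2 : ℕ) : ℝ) = (b - 1) / 2 := by
      obtain ⟨m, rfl⟩ := hb
      rw [show (2 * m + 1) / 2 = m by omega]
      push_cast
      ring
    rw [h1, h2]
    field_simp
    ring

/-- All three limit formulas have this shape with t = ±1; the difference from 3/4 is t/(4xy). -/
theorem abs_three_mul_add_div_sub_le {x y t : ℝ} (hx : 1 ≤ x) (hy : 0 < y) (ht : |t| ≤ 1) :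
    |(3 * x * y + t) / (4 * x * y) - 3 / 4| ≤ 1 / y := by
  have hx0 : 0 < x := by linarith
  have h1 : (3 * x * y + t) / (4 * x * y) - 3 / 4 = t / (4 * x * y) := by
    field_simp
    ring
  rw [h1, abs_div, abs_of_pos (by positivity : 0 < 4 * x * y)]
  apply div_le_div₀ zero_le_one ht hy
  nlinarith

theorem theorem4 (ω : ℕ → Circle) (hω : ∀ p : ℕ, 0 < p → IsPrimitiveRoot (ω p) p) :
    (∀ q₁ q₂ : ℕ, q₁ ≤ q₂ → Nat.Coprime q₁ q₂ →
      (Odd q₁ → Even q₂ →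
        Tendsto (fun p : ℕ => positivityRatio (cyclicGroup (ω p) q₁ q₂)) atTop
          (𝓝 ((3 * (q₁ : ℝ) * ((q₂ : ℝ) - (q₁ : ℝ)) + 1) /
            (4 * (q₁ : ℝ) * ((q₂ : ℝ) - (q₁ : ℝ)))))) ∧
      (Odd q₁ → Odd q₂ →
        Tendsto (fun p : ℕ => positivityRatio (cyclicGroup (ω p) q₁ q₂)) atTop
          (𝓝 ((3 * (q₁ : ℝ) * (q₂ : ℝ) + 1) / (4 * (q₁ : ℝ) * (q₂ : ℝ))))) ∧
      (Even q₁ → Odd q₂ →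
        Tendsto (fun p : ℕ => positivityRatio (cyclicGroup (ω p) q₁ q₂)) atTop
          (𝓝 ((3 * (q₂ : ℝ) * ((q₂ : ℝ) - (q₁ : ℝ)) - 1) /
            (4 * (q₂ : ℝ) * ((q₂ : ℝ) - (q₁ : ℝ))))))) ∧
    (∃ (L : ℕ → ℕ → ℝ) (M : ℕ → ℝ),
      (∀ q₁ q₂ : ℕ, q₁ ≤ q₂ → Nat.Coprime q₁ q₂ →
        Tendsto (fun p : ℕ => positivityRatio (cyclicGroup (ω p) q₁ q₂)) atTop
          (𝓝 (L q₁ q₂))) ∧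
      (∀ q₁ : ℕ, 0 < q₁ →
        Tendsto (L q₁) (atTop ⊓ 𝓟 {q₂ : ℕ | Nat.Coprime q₁ q₂}) (𝓝 (M q₁))) ∧
      Tendsto M atTop (𝓝 (3 / 4))) := by
  refine ⟨fun a b hab hcop => ⟨tendsto_positivityRatio_odd_even ω hω hab hcop,
    tendsto_positivityRatio_odd_odd ω hω hab hcop,
    tendsto_positivityRatio_even_odd ω hω hab hcop⟩, ?_⟩
  classical
  refine ⟨fun a b => if Odd a then
      if Even b then (3 * (a : ℝ) * ((b : ℝ) - a) + 1) / (4 * (a : ℝ) * ((b : ℝ) - a))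
      else (3 * (a : ℝ) * b + 1) / (4 * (a : ℝ) * b)
    else (3 * (b : ℝ) * ((b : ℝ) - a) - 1) / (4 * (b : ℝ) * ((b : ℝ) - a)),
    fun _ => 3 / 4, ?_, ?_, tendsto_const_nhds⟩
  · intro a b hab hcop
    by_cases ha : Odd a
    · by_cases hb : Even b
      · simpa only [ha, hb, if_true] using tendsto_positivityRatio_odd_even ω hω hab hcop ha hb
      · simpa only [ha, hb, if_true, if_false] using
          tendsto_positivityRatio_odd_odd ω hω hab hcop ha (Nat.not_even_iff_odd.1 hb)
    · have ha' : Even a := Nat.not_odd_iff_even.1 ha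
      have hb : Odd b := by
        rw [← Nat.not_even_iff_odd]
        intro hb
        exact Nat.not_coprime_of_dvd_of_dvd one_lt_two ha'.two_dvd hb.two_dvd hcop
      simpa only [ha, if_false] using tendsto_positivityRatio_even_odd ω hω hab hcop ha' hb
  · intro a ha
    -- The closed formulas converge along all q₂ → ∞, so coprimality can be dropped here.
    refine Tendsto.mono_left ?_ inf_le_left
    rw [tendsto_iff_norm_sub_tendsto_zero]
    have hlim : Tendsto (fun b : ℕ => 1 / ((b : ℝ) - a)) atTop (𝓝 0) := by
      have : Tendsto (fun b : ℕ => (b : ℝ) - a) atTop atTop :=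
        tendsto_atTop_add_const_right _ (-(a : ℝ)) tendsto_natCast_atTop_atTop
      simp only [one_div]
      exact this.inv_tendsto_atTop
    refine squeeze_zero' (Eventually.of_forall fun _ => norm_nonneg _) ?_ hlim
    filter_upwards [eventually_gt_atTop a] with b hb
    have ha' : (1 : ℝ) ≤ a := by exact_mod_cast ha
    have hb' : (a : ℝ) < b := by exact_mod_cast hb
    rw [Real.norm_eq_abs]
    split_ifs
    · exact abs_three_mul_add_div_sub_le ha' (by linarith) (by simp)
    · refine (abs_three_mul_add_div_sub_le ha' (by linarith) (by simp)).trans ?_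
      exact one_div_le_one_div_of_le (by linarith) (by linarith)
    · rw [sub_eq_add_neg (3 * (b : ℝ) * _) 1]
      exact abs_three_mul_add_div_sub_le (by linarith) (by linarith) (by simp)
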